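/- **Setting.** For a nonsingular $A\in\mathbb C^{n\times n}$ with singular value decomposition $A=U\Sigma V^*$, $0<\sigma_1\le\dots\le\sigma_n$, put $Q=VU^*$, so that $QA=\sqrt{A^*A}$ and $AQ=\sqrt{AA^*}$; for a positive definite matrix $M$ write $\|x\|_M^2=\langle Mx,x\rangle$. A matrix $P\in\mathbb C^{n\times m}$ has the fractional approximation property FAP$(\beta,\eta)$ with respect to $M$ with constant $K$ if for every $v$ there is $v_c$ with $\|v-Pv_c\|_{M^\eta}^2\le K\,\|M\|^{\eta-2\beta}\langle M^{2\beta}v,v\rangle$. Consider an AMG hierarchy with $L$ levels: a nonsingular matrix $A_1$, transfer matrices $P_\ell,R_\ell\in\mathbb C^{n_\ell\times n_{\ell+1}}$ with $n_{\ell+1}<n_\ell$ ($1\le \ell<L$) and $A_{\ell+1}=R_\ell^*A_\ell P_\ell$, normalized so that $\|A_\ell\|=1$ for all $\ell\le L$. Fix $\beta\ge 1$. Assume that for each $\ell<L$ the following holds for some $\gamma>0$ and some constants $K_{P,\ell},K_{R,\ell}$ (all other quantities may also depend on $\ell$; write $A=A_\ell$, $P=P_\ell$, $R=R_\ell$, $n_c=n_{\ell+1}$,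 $A_c=R^*AP$): $P^*P$ and $R^*R$ are spectrally equivalent to $I$; $P$ has FAP$(\beta,0)$ with respect to $QA$ with constant $K_{P,\ell}$; $R$ has FAP$(\gamma,0)$ with respect to $AQ$ with constant $K_{R,\ell}$; and there are a singular value decomposition of $A$ and an index $1\le k\le n_c$ such that 1. $\delta_P:=\sigma_k^{\beta}K_{P,\ell}^{1/2}<1/\sqrt2$; put $\widehat K_P=K_{P,\ell}/(1-\delta_P^2)$; 2. $\delta_R:=\sigma_k^{\gamma}K_{R,\ell}^{1/2}<1/\sqrt2$; put $\widehat K_R=K_{R,\ell}/(1-\delta_R^2)$; 3. $\delta_{PR}^2:=\sigma_k^{\beta+\gamma-1}(\widehat K_P\widehat K_R)^{1/2}<1/2$; 4. if $k<n_c$, then $s_1>\delta_{PR}^2/(1-\delta_{PR}^2)$, where $s_1$ is the cosine of the largest angle, in the $QA$ inner product, between $W_2$ and $QZ_2$; here $W_2$ is the set of vectors in the range of $P$ orthogonal to the first $k$ right singular vectors, and $Z_2$ the set of vectors in the range of $R$ orthogonal to the first $k$ left singular vectors; 5. $\sigma_k^{2\beta-1}\widehat K_P<1$. **Theorem (W-cycle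 convergence).** Under these hypotheses all $A_\ell$ are nonsingular, and there are constants $0<c_0\le c_1$ and $C_\Pi\ge1$ such that for all $\ell<L$ and all $x$ $$c_0\,\|P^*(QA)Px\|^2\le\|(A_c^*A_c)^{1/2}x\|^2\le c_1\,\|P^*(QA)Px\|^2\qquad(\mathrm{N})$$ and $$\|\Pi x\|_{QA}^2\le C_\Pi\|x\|_{QA}^2,\qquad \Pi=PA_c^{-1}R^*A .\qquad(\mathrm{S})$$ Moreover, let $0<c_0\le c_1$, $C_\Pi\ge1$ and $K_P$ be any constants such that (S) holds on all levels $\ell<L$; such that on all these levels (N) holds, or on all these levels the spectral equivalence $c_0\|Py\|_{QA}^2\le\|y\|^2_{(A_c^*A_c)^{1/2}}\le c_1\|Py\|^2_{QA}$ (for all $y$) holds; and such that $K_P\ge K_{P,\ell}$ for all $\ell<L$, or every $P_\ell$ has FAP$(\beta,1)$ with respect to $Q_\ell A_\ell$ with constant $K_P$. Set $C_\mu=2(c_1/c_0)C_\Pi$, and let $\nu$ be a natural number with $$\nu\ \ge\ \frac{2\beta-1}{4}\Bigl(4\,\frac{c_1}{c_0}\,K_P\,C_\Pi\,(2C_\Pi-1)\Bigr)^{2/(2\beta-1)}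 .$$ Consider the W-cycle which on each level $\ell<L$ performs $\nu$ Richardson sweeps $x\leftarrow x+A^*(b-Ax)/\|A\|^2$ on the normal equations, followed by a coarse-grid correction $x\leftarrow x+P\tilde e_c$, where $\tilde e_c$ results from two W-cycles with zero initial guess for $A_ce_c=R^*(b-Ax)$, and which solves exactly on level $L$. Then, for the W-cycle started on any level $\ell\le L$ (in particular the finest), one cycle for $A_\ell x=b$ changes the error $e$ into an error $e'$ with $$\|e'\|^2_{\sqrt{A_\ell^*A_\ell}}\le\rho\,\|e\|^2_{\sqrt{A_\ell^*A_\ell}},\qquad \rho=\frac1{2C_\mu}<1 ,$$ a bound that does not depend on the number of levels. -/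

import Mathlib

/-! Nonsymmetric algebraic multigrid: norms, approximation properties, hierarchies, W-cycles. -/

namespace AMG

noncomputable section

open Matrix

/-- `‖x‖²_M = ⟨M x, x⟩` for a Hermitian positive semidefinite matrix `M`. -/
def sqNorm {n : ℕ} (M : Matrix (Fin n) (Fin n) ℂ) (x : Fin n → ℂ) : ℝ :=
  (star x ⬝ᵥ (M *ᵥ x)).re

/-- The Euclidean (spectral) operator norm `‖M‖`. -/
def opNorm {n : ℕ} (M : Matrix (Fin n) (Fin n) ℂ) : ℝ :=
  ‖Matrix.toEuclideanCLM (n := Fin n) (𝕜 := ℂ) M‖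

/-- The real power `M ^ s` of a Hermitian positive semidefinite matrix (functional calculus). -/
def matPow {n : ℕ} (M : Matrix (Fin n) (Fin n) ℂ) (s : ℝ) : Matrix (Fin n) (Fin n) ℂ :=
  cfc (fun t : ℝ => t ^ s) M

/-- `QA = √(A* A)`. -/
def QA {n : ℕ} (A : Matrix (Fin n) (Fin n) ℂ) : Matrix (Fin n) (Fin n) ℂ :=
  cfc Real.sqrt (Aᴴ * A)

/-- `AQ = √(A A*)`. -/
def AQ {n : ℕ} (A : Matrix (Fin n) (Fin n) ℂ) : Matrix (Fin n) (Fin n) ℂ :=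
  cfc Real.sqrt (A * Aᴴ)

/-- Fractional approximation property FAP(`β`, `η`) of the transfer operator `P` with respect
to the positive semidefinite matrix `M`, with constant `K`. -/
def FAP {n m : ℕ} (M : Matrix (Fin n) (Fin n) ℂ) (P : Matrix (Fin n) (Fin m) ℂ)
    (β η K : ℝ) : Prop :=
  ∀ v : Fin n → ℂ, ∃ vc : Fin m → ℂ,
    sqNorm (matPow M η) (v - P *ᵥ vc)
      ≤ K / opNorm M ^ (2 * β - η) * sqNorm (matPow M (2 * β)) v

/-- `M ∼ₛ N`: spectral equivalence of Hermitian matrices. -/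
def SpecEquiv {m : ℕ} (M N : Matrix (Fin m) (Fin m) ℂ) : Prop :=
  ∃ a b : ℝ, 0 < a ∧ 0 < b ∧ ∀ x : Fin m → ℂ,
    a * sqNorm N x ≤ sqNorm M x ∧ sqNorm M x ≤ b * sqNorm N x

/-- A singular value decomposition `A = U Σ V*` with singular values in increasing order. The
`j`-th columns of `U` and `V` are the left and right singular vectors. -/
structure SVD {n : ℕ} (A : Matrix (Fin n) (Fin n) ℂ) where
  U : Matrix (Fin n) (Fin n) ℂ
  V : Matrix (Fin n) (Fin n) ℂ
  σ : Fin n → ℝ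
  U_mem : U ∈ Matrix.unitaryGroup (Fin n) ℂ
  V_mem : V ∈ Matrix.unitaryGroup (Fin n) ℂ
  nonneg : ∀ i, 0 ≤ σ i
  mono : Monotone σ
  eq : A = U * Matrix.diagonal (fun i => (σ i : ℂ)) * Vᴴ

/-- For a unitary `V` with columns `v_0, v_1, …`: the vectors of the range of `P` that are
orthogonal to the projections of `v_0, …, v_i` onto the range of `P`. For `w` in the range of `P`
this just says `⟨v_j, w⟩ = 0` for `j ≤ i`. -/
def highPart {n m : ℕ} (V : Matrix (Fin n) (Fin n) ℂ) (P : Matrix (Fin n) (Fin m) ℂ)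
    (i : Fin n) : Set (Fin n → ℂ) :=
  {w | (∃ c : Fin m → ℂ, w = P *ᵥ c) ∧ ∀ j : Fin n, j ≤ i → star (fun a => V a j) ⬝ᵥ w = 0}

/-- `s₁`, the smallest singular value of the sesquilinear form `⟨A w, z⟩` on `W × Z`, where `w` is
measured in the `QA`-norm and `z` in the `AQ`-norm; as `⟨A w, z⟩ = ⟨w, Q z⟩_{QA}`, this is the
cosine of the largest angle between `W` and `Q Z` in the `QA` inner product. -/
def cosMaxAngle {n : ℕ} (A : Matrix (Fin n) (Fin n) ℂ) (W Z : Set (Fin n → ℂ)) : ℝ :=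
  ⨅ w : {w : Fin n → ℂ // w ∈ W ∧ sqNorm (QA A) w = 1},
    ⨆ z : {z : Fin n → ℂ // z ∈ Z ∧ sqNorm (AQ A) z = 1},
      ‖star (z : Fin n → ℂ) ⬝ᵥ (A *ᵥ (w : Fin n → ℂ))‖

/-- The hypotheses of the lemma on equivalence of inner products, for one pair of consecutive
levels. The index `i` (counted from `0`) corresponds to `k = i + 1`, so `k ≤ m` reads `i < m`. -/
def EquivIPConditions {n m : ℕ} (A : Matrix (Fin n) (Fin n) ℂ)
    (P R : Matrix (Fin n) (Fin m) ℂ) (β γ KP KR : ℝ) : Prop :=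
  1 ≤ β ∧ 0 < γ ∧
  SpecEquiv (Pᴴ * P) 1 ∧ FAP (QA A) P β 0 KP ∧
  SpecEquiv (Rᴴ * R) 1 ∧ FAP (AQ A) R γ 0 KR ∧
  ∃ (S : SVD A) (i : Fin n) (δP δR KP' KR' δPR2 : ℝ), (i : ℕ) < m ∧
    δP = S.σ i ^ β * KP ^ (1 / 2 : ℝ) ∧ δP < 1 / Real.sqrt 2 ∧ KP' = KP / (1 - δP ^ 2) ∧
    δR = S.σ i ^ γ * KR ^ (1 / 2 : ℝ) ∧ δR < 1 / Real.sqrt 2 ∧ KR' = KR / (1 - δR ^ 2) ∧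
    δPR2 = S.σ i ^ (β + γ - 1) * (KP' * KR') ^ (1 / 2 : ℝ) ∧ δPR2 < 1 / 2 ∧
    ((i : ℕ) + 1 < m →
      δPR2 / (1 - δPR2) < cosMaxAngle A (highPart S.V P i) (highPart S.U R i)) ∧
    S.σ i ^ (2 * β - 1) * KP' < 1

/-- The non-orthogonal projection `Π = P A_c⁻¹ R* A`, with `A_c = R* A P`. -/
def cgProj {n m : ℕ} (A : Matrix (Fin n) (Fin n) ℂ) (P R : Matrix (Fin n) (Fin m) ℂ) :
    Matrix (Fin n) (Fin n) ℂ :=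
  P * (Rᴴ * A * P)⁻¹ * Rᴴ * A

/-- Stability: `‖Π‖²_{QA} ≤ C`. -/
def Stable {n m : ℕ} (A : Matrix (Fin n) (Fin n) ℂ) (P R : Matrix (Fin n) (Fin m) ℂ)
    (C : ℝ) : Prop :=
  ∀ x : Fin n → ℂ, sqNorm (QA A) (cgProj A P R *ᵥ x) ≤ C * sqNorm (QA A) x

/-- Norm equivalence of `(A_c* A_c)^{1/2}` and `P* (QA) P` with constants `c0`, `c1`. -/
def NormEquivIP {n m : ℕ} (A : Matrix (Fin n) (Fin n) ℂ) (P R : Matrix (Fin n) (Fin m) ℂ)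
    (c0 c1 : ℝ) : Prop :=
  ∀ x : Fin m → ℂ,
    c0 * sqNorm 1 ((Pᴴ * QA A * P) *ᵥ x) ≤ sqNorm 1 (QA (Rᴴ * A * P) *ᵥ x) ∧
    sqNorm 1 (QA (Rᴴ * A * P) *ᵥ x) ≤ c1 * sqNorm 1 ((Pᴴ * QA A * P) *ᵥ x)

/-- Spectral equivalence: `c0 ‖P y‖²_{QA} ≤ ‖y‖²_{(A_c* A_c)^{1/2}} ≤ c1 ‖P y‖²_{QA}`. -/
def SpecEquivIP {n m : ℕ} (A : Matrix (Fin n) (Fin n) ℂ) (P R : Matrix (Fin n) (Fin m) ℂ)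
    (c0 c1 : ℝ) : Prop :=
  ∀ y : Fin m → ℂ,
    c0 * sqNorm (QA A) (P *ᵥ y) ≤ sqNorm (QA (Rᴴ * A * P)) y ∧
    sqNorm (QA (Rᴴ * A * P)) y ≤ c1 * sqNorm (QA A) (P *ᵥ y)

/-- An AMG hierarchy with `L` levels, numbered `0` (finest), …, `L - 1` (coarsest). Only the
transfer operators `P ℓ`, `R ℓ` with `ℓ + 1 < L` belong to it; later entries are never used. -/
structure Hierarchy where
  L : ℕ
  dim : ℕ → ℕ
  fine : Matrix (Fin (dim 0)) (Fin (dim 0)) ℂ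
  P : ∀ ℓ, Matrix (Fin (dim ℓ)) (Fin (dim (ℓ + 1))) ℂ
  R : ∀ ℓ, Matrix (Fin (dim ℓ)) (Fin (dim (ℓ + 1))) ℂ

/-- The operators `A_{ℓ+1} = R_ℓ* A_ℓ P_ℓ`. -/
def Hierarchy.A (H : Hierarchy) : ∀ ℓ, Matrix (Fin (H.dim ℓ)) (Fin (H.dim ℓ)) ℂ
  | 0 => H.fine
  | ℓ + 1 => (H.R ℓ)ᴴ * H.A ℓ * H.P ℓ

/-- One sweep of Richardson relaxation on the normal equations of `A x = b`; its
error-propagation operator is `I - A* A / ‖A‖²`. -/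
def richardson {n : ℕ} (A : Matrix (Fin n) (Fin n) ℂ) (b x : Fin n → ℂ) : Fin n → ℂ :=
  x + (((1 / opNorm A ^ 2 : ℝ)) : ℂ) • (Aᴴ *ᵥ (b - A *ᵥ x))

/-- One W-cycle for `A_ℓ x = b` from the guess `x`, where `d` levels lie below level `ℓ`: an exact
solve if `d = 0`; otherwise `ν` relaxation sweeps, followed by a coarse-grid correction whose
coarse problem is treated by two W-cycles with zero initial guess. -/
def Hierarchy.wcycle (H : Hierarchy) (ν : ℕ) :
    ∀ (_d ℓ : ℕ), (Fin (H.dim ℓ) → ℂ) → (Fin (H.dim ℓ) → ℂ) → (Fin (H.dim ℓ) → ℂ)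
  | 0, ℓ, b, _ => (H.A ℓ)⁻¹ *ᵥ b
  | d + 1, ℓ, b, x =>
      let y := (richardson (H.A ℓ) b)^[ν] x
      let r := (H.R ℓ)ᴴ *ᵥ (b - H.A ℓ *ᵥ y)
      y + H.P ℓ *ᵥ H.wcycle ν d (ℓ + 1) r (H.wcycle ν d (ℓ + 1) r 0)

end

end AMG

/-! In the singular bases of `A` the matrix `QA A` becomes diag σ and the form ⟨Aw, z⟩ becomes Σ σ_j
w_j conj(z_j). Both halves of the theorem are estimates in these coordinates.

Nonsingularity (`EquivIPConditions.isUnit_det`) passes from each level to the next. A kernel vector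
of R*AP yields w in the range of P with ⟨Aw, z⟩ = 0 for all z in the range of R. The low singular
vectors are well approximated by both ranges, so a low vector p lifts to either range by adding a
small high error (`exists_mem_eq_on_low`). Write w = p + q + w₂, with p the low part of w, p + q its
lift, and w₂ high. Testing with high z bounds the energy norm of w₂ by that of q over s₁. Testing
with the lift of a weighted p bounds a weighted square norm T of p by (1 + 1/s₁)δ_PR² T, and
condition 4 makes this factor less than 1 (`eq_zero_of_forall_form_eq_zero`). Uniform constants in
(N) and (S) then exist because there are finitely many levels.

Convergence is an induction over levels (`sqNorm_wcycle_step_le`). With g the smoothed error, the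
cycle leaves g − Πg + Py, where y is the error of the coarse solve. As Π fixes the range of P, the
energy is at most (2C − 1) times the squared distance of g to that range, plus 2‖Py‖². The
approximation property bounds the first term by ⟨(QA)^{2β}g, g⟩. Two coarse cycles give a factor ρ²,
and stability and norm equivalence turn the second term into at most ρ/2 times the energy of g,
because ρ = 1/(2C_μ). The smoothing filter (1 − σ²)^ν absorbs both terms at once for the assumed ν
(`SVD.smoothing_bound`), which reproduces the factor ρ. -/

namespace AMG

open Matrix
open scoped ComplexOrder

/-! ### Functional calculus and norms in singular coordinates -/

section Spectral

variable {n : ℕ}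

/-- The algebra homomorphism `x ↦ V diag(x) V*` for a unitary matrix `V`. -/
noncomputable def unitaryDiagonal (V : Matrix (Fin n) (Fin n) ℂ)
    (hV : V ∈ Matrix.unitaryGroup (Fin n) ℂ) :
    (Fin n → ℝ) →ₐ[ℝ] Matrix (Fin n) (Fin n) ℂ :=
  AlgHom.ofLinearMap
    { toFun := fun x => V * diagonal (fun j => (x j : ℂ)) * Vᴴ
      map_add' := fun x y => by
        simp only [Pi.add_apply, Complex.ofReal_add, ← diagonal_add, mul_add, add_mul]
      map_smul' := fun c x => by
        have : diagonal (fun j => (((c • x) j : ℝ) : ℂ)) = c • diagonal (fun j => (x j : ℂ)) := by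
          rw [← diagonal_smul]; congr 1; ext j; simp
        rw [this, mul_smul_comm, smul_mul_assoc, RingHom.id_apply] }
    (by simpa [star_eq_conjTranspose] using Matrix.mem_unitaryGroup_iff.mp hV)
    (fun x y => by
      have h : Vᴴ * V = 1 := by
        simpa [star_eq_conjTranspose] using Matrix.mem_unitaryGroup_iff'.mp hV
      have : diagonal (fun j => (((x * y) j : ℝ) : ℂ))
          = diagonal (fun j => (x j : ℂ)) * (Vᴴ * V) * diagonal (fun j => (y j : ℂ)) := by
        rw [h, mul_one, diagonal_mul_diagonal]; simp
      change V * diagonal (fun j => (((x * y) j : ℝ) : ℂ)) * Vᴴ = _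
      rw [this]; simp only [LinearMap.coe_mk, AddHom.coe_mk, Matrix.mul_assoc])

theorem unitaryDiagonal_apply (V : Matrix (Fin n) (Fin n) ℂ)
    (hV : V ∈ Matrix.unitaryGroup (Fin n) ℂ) (x : Fin n → ℝ) :
    unitaryDiagonal V hV x = V * diagonal (fun j => (x j : ℂ)) * Vᴴ := rfl

theorem isHermitian_unitaryDiagonal (V : Matrix (Fin n) (Fin n) ℂ)
    (hV : V ∈ Matrix.unitaryGroup (Fin n) ℂ) (x : Fin n → ℝ) :
    (unitaryDiagonal V hV x).IsHermitian := by
  rw [unitaryDiagonal_apply, IsHermitian, conjTranspose_mul, conjTranspose_mul,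
    conjTranspose_conjTranspose, diagonal_conjTranspose, Matrix.mul_assoc]
  congr 3
  ext j; simp

theorem spectrum_unitaryDiagonal_subset (V : Matrix (Fin n) (Fin n) ℂ)
    (hV : V ∈ Matrix.unitaryGroup (Fin n) ℂ) (x : Fin n → ℝ) :
    spectrum ℝ (unitaryDiagonal V hV x) ⊆ Set.range x := by
  refine (AlgHom.spectrum_apply_subset _ _).trans fun t ht => ?_
  by_contra h
  refine ht (Pi.isUnit_iff.2 fun j => ?_)
  rw [isUnit_iff_ne_zero]
  intro h0
  exact h ⟨j, by simpa [sub_eq_zero, eq_comm] using h0⟩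

/-- The spectrum is finite, so `f` may be replaced by a Lagrange interpolant, and polynomials
commute with the algebra homomorphism. No continuity of `f` is needed, and the entries of `x` may
repeat. -/
theorem cfc_unitaryDiagonal (V : Matrix (Fin n) (Fin n) ℂ)
    (hV : V ∈ Matrix.unitaryGroup (Fin n) ℂ) (x : Fin n → ℝ) (f : ℝ → ℝ) :
    cfc f (unitaryDiagonal V hV x) = unitaryDiagonal V hV (fun j => f (x j)) := by
  classical
  let p := Lagrange.interpolate (Finset.univ.image x) id f
  have hp : ∀ j, p.eval (x j) = f (x j) := fun j =>
    Lagrange.eval_interpolate_at_node (v := id) f (Set.injOn_id _)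
      (Finset.mem_image_of_mem x (Finset.mem_univ j))
  rw [cfc_congr (g := p.eval)]
  · refine (cfc_polynomial p _ (isHermitian_unitaryDiagonal V hV x)).trans ?_
    rw [Polynomial.aeval_algHom_apply]
    congr 1
    ext j
    rw [← hp]
    simp [Polynomial.aeval_fn_apply]
  · intro t ht
    obtain ⟨j, rfl⟩ := spectrum_unitaryDiagonal_subset V hV x ht
    exact (hp j).symm

theorem star_dotProduct_mulVec_conj (U V : Matrix (Fin n) (Fin n) ℂ) (d : Fin n → ℂ)
    (z w : Fin n → ℂ) :
    star z ⬝ᵥ ((U * diagonal d * Vᴴ) *ᵥ w)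
      = ∑ j, star ((Uᴴ *ᵥ z) j) * (d j * (Vᴴ *ᵥ w) j) := by
  rw [Matrix.mul_assoc, ← mulVec_mulVec, dotProduct_mulVec, ← mulVec_mulVec]
  have : star z ᵥ* U = star (Uᴴ *ᵥ z) := by rw [star_mulVec, conjTranspose_conjTranspose]
  rw [this]
  simp [dotProduct, mulVec_diagonal]

theorem sqNorm_unitaryDiagonal (V : Matrix (Fin n) (Fin n) ℂ)
    (hV : V ∈ Matrix.unitaryGroup (Fin n) ℂ) (x : Fin n → ℝ) (v : Fin n → ℂ) :
    sqNorm (unitaryDiagonal V hV x) v = ∑ j, x j * ‖(Vᴴ *ᵥ v) j‖ ^ 2 := by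
  rw [sqNorm, unitaryDiagonal_apply, star_dotProduct_mulVec_conj, Complex.re_sum]
  refine Finset.sum_congr rfl fun j _ => ?_
  rw [mul_left_comm, Complex.re_ofReal_mul, Complex.star_def, Complex.conj_mul',
    ← Complex.ofReal_pow, Complex.ofReal_re]

theorem sqNorm_one (v : Fin n → ℂ) : sqNorm 1 v = ∑ j, ‖v j‖ ^ 2 := by
  have h := sqNorm_unitaryDiagonal (1 : Matrix (Fin n) (Fin n) ℂ) (one_mem _) 1 v
  simpa [map_one] using h

namespace SVD

variable {A : Matrix (Fin n) (Fin n) ℂ} (S : SVD A)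
include S

theorem V_conj_mul : S.Vᴴ * S.V = 1 := by
  simpa [star_eq_conjTranspose] using Matrix.mem_unitaryGroup_iff'.mp S.V_mem

theorem U_conj_mul : S.Uᴴ * S.U = 1 := by
  simpa [star_eq_conjTranspose] using Matrix.mem_unitaryGroup_iff'.mp S.U_mem

theorem V_mul_conj : S.V * S.Vᴴ = 1 := by
  simpa [star_eq_conjTranspose] using Matrix.mem_unitaryGroup_iff.mp S.V_mem

omit S in
/-- The singular value decomposition `A* = V Σ U*`. -/
def adjoint (S : SVD A) : SVD Aᴴ where
  U := S.V
  V := S.U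
  σ := S.σ
  U_mem := S.V_mem
  V_mem := S.U_mem
  nonneg := S.nonneg
  mono := S.mono
  eq := by
    conv_lhs => rw [S.eq]
    rw [conjTranspose_mul, conjTranspose_mul, conjTranspose_conjTranspose,
      diagonal_conjTranspose, Matrix.mul_assoc]
    congr 3
    ext j; simp

theorem conjTranspose_mul_self : Aᴴ * A = unitaryDiagonal S.V S.V_mem (S.σ ^ 2) := by
  have e : Aᴴ * A = S.V * diagonal (fun j => (S.σ j : ℂ)) * S.Uᴴ
      * (S.U * diagonal (fun j => (S.σ j : ℂ)) * S.Vᴴ) :=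
    congr_arg₂ (· * ·) S.adjoint.eq S.eq
  rw [pow_two, map_mul, unitaryDiagonal_apply, e]
  have h : ∀ D : Matrix (Fin n) (Fin n) ℂ,
      S.V * D * S.Uᴴ * (S.U * D * S.Vᴴ) = S.V * D * (S.Uᴴ * S.U) * (D * S.Vᴴ) := by
    intro D; simp only [Matrix.mul_assoc]
  have h' : ∀ D : Matrix (Fin n) (Fin n) ℂ,
      S.V * D * S.Vᴴ * (S.V * D * S.Vᴴ) = S.V * D * (S.Vᴴ * S.V) * (D * S.Vᴴ) := by
    intro D; simp only [Matrix.mul_assoc]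
  rw [h', S.V_conj_mul, ← S.U_conj_mul]
  exact h _

theorem QA_eq : QA A = unitaryDiagonal S.V S.V_mem S.σ := by
  rw [QA, S.conjTranspose_mul_self, cfc_unitaryDiagonal]
  congr 1
  ext j
  exact Real.sqrt_sq (S.nonneg j)

theorem sqNorm_QA (v : Fin n → ℂ) : sqNorm (QA A) v = ∑ j, S.σ j * ‖(S.Vᴴ *ᵥ v) j‖ ^ 2 := by
  rw [S.QA_eq, sqNorm_unitaryDiagonal]

theorem sqNorm_matPow_QA (s : ℝ) (v : Fin n → ℂ) :
    sqNorm (matPow (QA A) s) v = ∑ j, S.σ j ^ s * ‖(S.Vᴴ *ᵥ v) j‖ ^ 2 := by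
  rw [S.QA_eq, matPow, cfc_unitaryDiagonal, sqNorm_unitaryDiagonal]

theorem star_dotProduct_mulVec (z w : Fin n → ℂ) :
    star z ⬝ᵥ (A *ᵥ w) = ∑ j, star ((S.Uᴴ *ᵥ z) j) * (S.σ j * (S.Vᴴ *ᵥ w) j) := by
  conv_lhs => rw [S.eq]
  exact star_dotProduct_mulVec_conj _ _ _ _ _

theorem pos (hA : IsUnit A.det) (j : Fin n) : 0 < S.σ j := by
  refine lt_of_le_of_ne (S.nonneg j) fun h => ?_
  rw [S.eq, det_mul, det_mul, det_diagonal,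
    Finset.prod_eq_zero (Finset.mem_univ j) (by simp [← h])] at hA
  simp at hA

end SVD

/-- Together with `SVD.adjoint` this lets every result about `P` and `A` be applied to `R` and `Aᴴ`.
-/
theorem AQ_eq_QA_conjTranspose (A : Matrix (Fin n) (Fin n) ℂ) : AQ A = QA Aᴴ := by
  rw [AQ, QA, conjTranspose_conjTranspose]

theorem QA_posSemidef (A : Matrix (Fin n) (Fin n) ℂ) : (QA A).PosSemidef := by
  have hA := (isHermitian_conjTranspose_mul_self A)
  have hc : (QA A).IsHermitian := cfc_predicate Real.sqrt (Aᴴ * A)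
  rw [hc.posSemidef_iff_eigenvalues_nonneg]
  intro i
  have hs : spectrum ℝ (QA A) = Real.sqrt '' spectrum ℝ (Aᴴ * A) :=
    cfc_map_spectrum Real.sqrt (Aᴴ * A) hA
  obtain ⟨t, -, ht⟩ := hs ▸ hc.eigenvalues_mem_spectrum_real i
  rw [Pi.zero_apply]
  exact ht ▸ Real.sqrt_nonneg t

theorem QA_mul_QA (A : Matrix (Fin n) (Fin n) ℂ) : QA A * QA A = Aᴴ * A := by
  have hA := isHermitian_conjTranspose_mul_self A
  rw [QA, ← cfc_mul Real.sqrt Real.sqrt (Aᴴ * A) (by fun_prop) (by fun_prop)]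
  conv_rhs => rw [← cfc_id' ℝ (Aᴴ * A) hA]
  refine cfc_congr fun t ht => Real.mul_self_sqrt ?_
  obtain ⟨i, rfl⟩ : t ∈ Set.range hA.eigenvalues := hA.spectrum_real_eq_range_eigenvalues ▸ ht
  exact (posSemidef_conjTranspose_mul_self A).eigenvalues_nonneg i

/-- By the C*-identity both norms have the square ‖A*A‖. Hence the normalization of `A` also removes
the powers of the norm in `FAP`. -/
theorem opNorm_QA (A : Matrix (Fin n) (Fin n) ℂ) : opNorm (QA A) = opNorm A := by
  have h : ∀ M : Matrix (Fin n) (Fin n) ℂ, opNorm (Mᴴ * M) = opNorm M * opNorm M := by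
    intro M
    have e : toEuclideanCLM (n := Fin n) (𝕜 := ℂ) (Mᴴ * M)
        = star (toEuclideanCLM (n := Fin n) (𝕜 := ℂ) M)
          * toEuclideanCLM (n := Fin n) (𝕜 := ℂ) M := by
      rw [← star_eq_conjTranspose, map_mul, map_star]
    rw [opNorm, e]
    exact CStarRing.norm_star_mul_self (x := toEuclideanCLM (n := Fin n) (𝕜 := ℂ) M)
  have h1 := h (QA A)
  rw [(QA_posSemidef A).1, QA_mul_QA, h A] at h1
  exact (mul_self_inj (norm_nonneg _) (norm_nonneg _)).1 h1.symm

theorem opNorm_conjTranspose (A : Matrix (Fin n) (Fin n) ℂ) : opNorm Aᴴ = opNorm A := by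
  rw [opNorm, opNorm, ← star_eq_conjTranspose, map_star, ContinuousLinearMap.star_eq_adjoint]
  exact LinearIsometryEquiv.norm_map ContinuousLinearMap.adjoint _

theorem sqNorm_one_eq_norm (v : Fin n → ℂ) : sqNorm 1 v = ‖WithLp.toLp 2 v‖ ^ 2 := by
  rw [sqNorm_one, EuclideanSpace.norm_sq_eq]

theorem sqNorm_one_mulVec_le (M : Matrix (Fin n) (Fin n) ℂ) (v : Fin n → ℂ) :
    sqNorm 1 (M *ᵥ v) ≤ opNorm M ^ 2 * sqNorm 1 v := by
  rw [sqNorm_one_eq_norm, sqNorm_one_eq_norm, ← mul_pow]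
  gcongr
  exact (toEuclideanCLM (n := Fin n) (𝕜 := ℂ) M).le_opNorm (WithLp.toLp 2 v)

theorem SVD.le_opNorm {A : Matrix (Fin n) (Fin n) ℂ} (S : SVD A) (j : Fin n) :
    S.σ j ≤ opNorm A := by
  have h := sqNorm_one_mulVec_le (QA A) (S.V *ᵥ Pi.single j 1)
  have e : ∀ x : Fin n → ℂ, sqNorm 1 x = ∑ j, ‖(S.Vᴴ *ᵥ x) j‖ ^ 2 := by
    intro x
    have h := sqNorm_unitaryDiagonal S.V S.V_mem 1 x
    simpa using h
  rw [e, e, opNorm_QA] at h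
  have e1 : S.Vᴴ *ᵥ (S.V *ᵥ Pi.single j (1 : ℂ)) = Pi.single j 1 := by
    rw [mulVec_mulVec, S.V_conj_mul, one_mulVec]
  have e2 : S.Vᴴ *ᵥ (QA A *ᵥ (S.V *ᵥ Pi.single j (1 : ℂ))) = Pi.single j (S.σ j : ℂ) := by
    rw [S.QA_eq, unitaryDiagonal_apply, ← mulVec_mulVec, e1, ← mulVec_mulVec, mulVec_mulVec,
      S.V_conj_mul, one_mulVec]
    ext i
    rw [mulVec_diagonal]
    rcases eq_or_ne i j with rfl | hij <;> simp [*]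
  rw [e1, e2, Finset.sum_eq_single j, Finset.sum_eq_single j] at h
  · rw [Pi.single_eq_same, Pi.single_eq_same, Complex.norm_real, norm_one, one_pow, mul_one,
      Real.norm_eq_abs, sq_abs] at h
    exact (pow_le_pow_iff_left₀ (S.nonneg j) (norm_nonneg _) two_ne_zero).1 h
  all_goals simp +contextual
end Spectral

/-! ### Lifting low vectors to an approximating subspace -/

section Lift

open Submodule

variable {E : Type*} [NormedAddCommGroup E] [InnerProductSpace ℂ E] [FiniteDimensional ℂ E]

theorem norm_sq_eq_starProjection_add (W : Submodule ℂ E) (x : E) :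
    ‖x‖ ^ 2 = ‖W.starProjection x‖ ^ 2 + ‖x - W.starProjection x‖ ^ 2 := by
  have h := norm_sq_eq_add_norm_sq_starProjection x W
  rwa [starProjection_orthogonal_val] at h

/-- If the vectors of `V` are approximated by `W` up to the relative error `δ < 1`, then `W` has
an element with any prescribed projection onto `V`, close to that projection. -/
theorem exists_mem_sub_mem_orthogonal (V W : Submodule ℂ E) {δ2 : ℝ} (hδ0 : 0 ≤ δ2) (hδ : δ2 < 1)
    (h : ∀ v ∈ V, ‖v - W.starProjection v‖ ^ 2 ≤ δ2 * ‖v‖ ^ 2) {x : E} (hx : x ∈ V) :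
    ∃ z ∈ W, z - x ∈ Vᗮ ∧ (1 - δ2) * ‖z - x‖ ^ 2 ≤ ‖x - W.starProjection x‖ ^ 2 := by
  have low : ∀ v ∈ V, (1 - δ2) * ‖v‖ ^ 2 ≤ ‖W.starProjection v‖ ^ 2 := fun v hv => by
    linarith [h v hv, norm_sq_eq_starProjection_add W v]
  have pair : ∀ v ∈ V, ‖W.starProjection v‖ ^ 2
      ≤ ‖V.starProjection (W.starProjection v)‖ * ‖v‖ := fun v hv => by
    have e : inner ℂ (V.starProjection (W.starProjection v)) v
        = inner ℂ (W.starProjection v) v := by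
      rw [inner_starProjection_left_eq_right, starProjection_eq_self_iff.2 hv]
    calc ‖W.starProjection v‖ ^ 2 = RCLike.re (inner ℂ (W.starProjection v) v) :=
          (W.re_inner_starProjection_eq_normSq v).symm
      _ ≤ ‖inner ℂ (V.starProjection (W.starProjection v)) v‖ := by
          rw [e]; exact RCLike.re_le_norm _
      _ ≤ _ := norm_inner_le_norm _ _
  have inj : Function.Injective ((V.starProjection ∘L W.starProjection).toLinearMap.restrict
      (p := V) (q := V) fun v _ => starProjection_apply_mem V _) := by
    rw [← LinearMap.ker_eq_bot, LinearMap.ker_eq_bot']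
    intro v hv
    have hv0 : V.starProjection (W.starProjection (v : E)) = 0 := congr_arg Subtype.val hv
    have h1 := pair v v.2
    rw [hv0, norm_zero, zero_mul] at h1
    have h2 := low v v.2
    have h3 : ‖(v : E)‖ ^ 2 ≤ 0 := by
      by_contra! h4
      nlinarith [mul_pos (sub_pos.2 hδ) h4]
    have h5 : ‖(v : E)‖ = 0 := by nlinarith [norm_nonneg (v : E)]
    exact Subtype.ext (norm_eq_zero.1 h5)
  -- An injective endomorphism of the finite-dimensional `V` is onto; the lift of `x` is the
  -- projection to `W` of its preimage `v`.
  obtain ⟨⟨v, hv⟩, hvx⟩ := (LinearMap.injective_iff_surjective.1 inj) ⟨x, hx⟩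
  have hvx : V.starProjection (W.starProjection v) = x := congr_arg Subtype.val hvx
  refine ⟨W.starProjection v, starProjection_apply_mem W v, ?_, ?_⟩
  · rw [← hvx]; exact sub_starProjection_mem_orthogonal _
  set q := W.starProjection v - x with hq
  have hqV : q ∈ Vᗮ := by rw [hq, ← hvx]; exact sub_starProjection_mem_orthogonal _
  have hFF : ∀ y, W.starProjection (W.starProjection y) = W.starProjection y := fun y =>
    starProjection_eq_self_iff.2 (starProjection_apply_mem W y)
  -- The lift lies in `W`, so `q` and `-x` have the same component off `W`. Only the component of
  -- `q` inside `W` remains to be bounded.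
  have e1 : q - W.starProjection q = -(x - W.starProjection x) := by
    rw [hq, map_sub, hFF]; abel
  have hFq : W.starProjection q = W.starProjection (v - x) := by
    rw [hq, map_sub, map_sub, hFF]
  have e2 := norm_sq_eq_starProjection_add W q
  rw [e1, norm_neg] at e2
  suffices hs : ‖W.starProjection q‖ ^ 2 ≤ δ2 * ‖q‖ ^ 2 by linarith
  set f := W.starProjection q with hf
  have hvxV : v - x ∈ V := V.sub_mem hv hx
  -- Symmetry of the gap: `f` is the projection to `W` of a vector of `V`, and such vectors are as
  -- close to `V` as vectors of `V` are to `W`.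
  have hgap : ‖f - V.starProjection f‖ ^ 2 ≤ δ2 * ‖f‖ ^ 2 := by
    have h1 := pair _ hvxV
    have h2 := low _ hvxV
    rw [← hFq] at h1 h2
    have h3 := norm_sq_eq_starProjection_add V f
    suffices (1 - δ2) * ‖f‖ ^ 2 ≤ ‖V.starProjection f‖ ^ 2 by linarith
    rcases (norm_nonneg (v - x)).eq_or_lt with h0 | h0
    · rw [← h0, mul_zero] at h1
      nlinarith [sq_nonneg ‖V.starProjection f‖, sq_nonneg ‖f‖]
    have h4 : (‖f‖ ^ 2) ^ 2 ≤ (‖V.starProjection f‖ * ‖v - x‖) ^ 2 :=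
      pow_le_pow_left₀ (by positivity) h1 2
    refine le_of_mul_le_mul_right ?_ (pow_pos h0 2)
    calc (1 - δ2) * ‖f‖ ^ 2 * ‖v - x‖ ^ 2 = (1 - δ2) * ‖v - x‖ ^ 2 * ‖f‖ ^ 2 := by ring
      _ ≤ ‖f‖ ^ 2 * ‖f‖ ^ 2 := by gcongr
      _ ≤ _ := by rwa [mul_pow, pow_two (‖f‖ ^ 2)] at h4
  -- As `q` is orthogonal to `V`, it pairs only with the part of `f` off `V`, which is small by
  -- `hgap`.
  have hqf : ‖f‖ ^ 2 ≤ ‖q‖ * ‖f - V.starProjection f‖ := by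
    have e : inner ℂ q f = inner ℂ q (f - V.starProjection f) := by
      rw [inner_sub_right, inner_left_of_mem_orthogonal (starProjection_apply_mem V f) hqV,
        sub_zero]
    calc ‖f‖ ^ 2 = RCLike.re (inner ℂ f q) := (W.re_inner_starProjection_eq_normSq q).symm
      _ ≤ ‖inner ℂ f q‖ := RCLike.re_le_norm _
      _ = ‖inner ℂ q (f - V.starProjection f)‖ := by rw [← e, norm_inner_symm]
      _ ≤ _ := norm_inner_le_norm _ _
  rcases (norm_nonneg f).eq_or_lt with h0 | h0
  · rw [← h0]; simpa using mul_nonneg hδ0 (sq_nonneg ‖q‖)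
  have h4 : (‖f‖ ^ 2) ^ 2 ≤ (‖q‖ * ‖f - V.starProjection f‖) ^ 2 :=
    pow_le_pow_left₀ (by positivity) hqf 2
  refine le_of_mul_le_mul_right ?_ (pow_pos h0 2)
  calc ‖f‖ ^ 2 * ‖f‖ ^ 2 ≤ ‖q‖ ^ 2 * ‖f - V.starProjection f‖ ^ 2 := by
        rwa [mul_pow, pow_two (‖f‖ ^ 2)] at h4
    _ ≤ ‖q‖ ^ 2 * (δ2 * ‖f‖ ^ 2) := by gcongr
    _ = _ := by ring

/-- The coordinate form of `exists_mem_sub_mem_orthogonal`, with `V` spanned by the first unit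
vectors, up to the index `i`. -/
theorem exists_mem_eq_on_low {n : ℕ} (W : Submodule ℂ (Fin n → ℂ)) (i : Fin n) (c : Fin n → ℝ)
    {δ2 : ℝ} (hδ0 : 0 ≤ δ2) (hδ : δ2 < 1) (hc : ∀ j ≤ i, c j ≤ δ2)
    (h : ∀ v : Fin n → ℂ, ∃ w ∈ W, ∑ j, ‖v j - w j‖ ^ 2 ≤ ∑ j, c j * ‖v j‖ ^ 2)
    {x : Fin n → ℂ} (hx : ∀ j, i < j → x j = 0) :
    ∃ z ∈ W, (∀ j ≤ i, z j = x j) ∧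
      (1 - δ2) * ∑ j, ‖z j - x j‖ ^ 2 ≤ ∑ j, c j * ‖x j‖ ^ 2 := by
  let e := (WithLp.linearEquiv 2 ℂ (Fin n → ℂ))
  let W' : Submodule ℂ (EuclideanSpace ℂ (Fin n)) := W.comap e.toLinearMap
  let V : Submodule ℂ (EuclideanSpace ℂ (Fin n)) :=
    { carrier := {y | ∀ j, i < j → y j = 0}
      add_mem' := fun ha hb j hj => by simp [ha j hj, hb j hj]
      zero_mem' := fun j _ => rfl
      smul_mem' := fun a y hy j hj => by simp [hy j hj] }
  have hap : ∀ v : EuclideanSpace ℂ (Fin n),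
      ‖v - W'.starProjection v‖ ^ 2 ≤ ∑ j, c j * ‖v j‖ ^ 2 := by
    intro v
    obtain ⟨w, hw, hvw⟩ := h v
    refine le_trans ?_ hvw
    have h1 : ‖v - W'.starProjection v‖ ≤ ‖v - WithLp.toLp 2 w‖ := by
      rw [starProjection_minimal]
      exact ciInf_le ⟨0, by rintro _ ⟨y, rfl⟩; exact norm_nonneg _⟩ (⟨WithLp.toLp 2 w, hw⟩ : W')
    calc _ ≤ ‖v - WithLp.toLp 2 w‖ ^ 2 := by gcongr
      _ = _ := by rw [EuclideanSpace.norm_sq_eq]; rfl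
  obtain ⟨z, hzW, hzV, hz⟩ := exists_mem_sub_mem_orthogonal V W' hδ0 hδ (fun v hv => by
    refine (hap v).trans ?_
    rw [EuclideanSpace.norm_sq_eq, Finset.mul_sum]
    refine Finset.sum_le_sum fun j _ => ?_
    rcases le_or_gt j i with hj | hj
    · exact mul_le_mul_of_nonneg_right (hc j hj) (by positivity)
    · simp [hv j hj]) (x := WithLp.toLp 2 x) hx
  refine ⟨z, hzW, fun j hj => ?_, ?_⟩
  · have hm : EuclideanSpace.single j (1 : ℂ) ∈ V := fun k hk => by
      simp [(hj.trans_lt hk).ne']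
    have := inner_right_of_mem_orthogonal hm hzV
    rw [EuclideanSpace.inner_single_left] at this
    simpa [sub_eq_zero] using this
  · refine le_trans (le_of_eq ?_) (hz.trans (hap _))
    rw [EuclideanSpace.norm_sq_eq]; rfl

end Lift

/-! ### Nondegeneracy of the form on the two ranges -/

section InfSup

variable {n : ℕ}

/-- The vector `x` rescaled so that its Euclidean norm is the `diag(σ)`-norm of `x`. -/
noncomputable def energyVec (σ : Fin n → ℝ) (x : Fin n → ℂ) : EuclideanSpace ℂ (Fin n) :=
  WithLp.toLp 2 fun j => (Real.sqrt (σ j) : ℂ) * x j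

theorem energyVec_zero (σ : Fin n → ℝ) : energyVec σ 0 = 0 := by
  ext j; simp [energyVec]

theorem norm_energyVec_sq {σ : Fin n → ℝ} (hσ : ∀ j, 0 ≤ σ j) (x : Fin n → ℂ) :
    ‖energyVec σ x‖ ^ 2 = ∑ j, σ j * ‖x j‖ ^ 2 := by
  rw [EuclideanSpace.norm_sq_eq]
  refine Finset.sum_congr rfl fun j _ => ?_
  rw [energyVec, norm_mul, mul_pow, Complex.norm_real, Real.norm_eq_abs, sq_abs,
    Real.sq_sqrt (hσ j)]

theorem norm_energyVec_add_le (σ : Fin n → ℝ) (x y : Fin n → ℂ) :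
    ‖energyVec σ (x + y)‖ ≤ ‖energyVec σ x‖ + ‖energyVec σ y‖ := by
  have : energyVec σ (x + y) = energyVec σ x + energyVec σ y := by
    ext j; simp [energyVec, mul_add]
  rw [this]
  exact norm_add_le _ _

theorem norm_sum_star_mul_le {σ : Fin n → ℝ} (hσ : ∀ j, 0 ≤ σ j) (z w : Fin n → ℂ) :
    ‖∑ j, star (z j) * (σ j * w j)‖ ≤ ‖energyVec σ z‖ * ‖energyVec σ w‖ := by
  have : ∑ j, star (z j) * (σ j * w j) = inner ℂ (energyVec σ z) (energyVec σ w) := by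
    rw [PiLp.inner_apply]
    refine Finset.sum_congr rfl fun j _ => ?_
    have h : (σ j : ℂ) = (Real.sqrt (σ j) : ℂ) * Real.sqrt (σ j) := by
      rw [← Complex.ofReal_mul, Real.mul_self_sqrt (hσ j)]
    simp only [energyVec, RCLike.inner_apply, map_mul, Complex.conj_ofReal, Complex.star_def]
    rw [h]; ring
  rw [this]
  exact norm_inner_le_norm _ _

/-- Nondegeneracy of the form `⟨diag(σ) w, z⟩` on `W × Z`, for subspaces `W` and `Z` that
approximate the first unit vectors well, under an angle condition on the vectors of `W` and `Z`
orthogonal to those. -/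
theorem eq_zero_of_forall_form_eq_zero (σ : Fin n → ℝ) (hσ : ∀ j, 0 < σ j) (hmono : Monotone σ)
    (hσ1 : ∀ j, σ j ≤ 1) (i : Fin n) (W Z : Submodule ℂ (Fin n → ℂ))
    {β γ KP' KR' δ2 s : ℝ} (hβγ : 0 ≤ β + γ - 1) (hKP' : 0 ≤ KP') (hKR' : 0 ≤ KR')
    (hW : ∀ x : Fin n → ℂ, (∀ j, i < j → x j = 0) → ∃ w ∈ W, (∀ j ≤ i, w j = x j) ∧
      ∑ j, ‖w j - x j‖ ^ 2 ≤ KP' * ∑ j, σ j ^ (2 * β) * ‖x j‖ ^ 2)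
    (hZ : ∀ x : Fin n → ℂ, (∀ j, i < j → x j = 0) → ∃ z ∈ Z, (∀ j ≤ i, z j = x j) ∧
      ∑ j, ‖z j - x j‖ ^ 2 ≤ KR' * ∑ j, σ j ^ (2 * γ) * ‖x j‖ ^ 2)
    (hδ : δ2 = σ i ^ (β + γ - 1) * (KP' * KR') ^ (1 / 2 : ℝ)) (hδ1 : δ2 < 1 / 2)
    (hs : δ2 / (1 - δ2) < s)
    (hang : ∀ w ∈ W, (∀ j ≤ i, w j = 0) → ∀ t : ℝ, 0 ≤ t →
      (∀ z ∈ Z, (∀ j ≤ i, z j = 0) →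
        ‖∑ j, star (z j) * (σ j * w j)‖ ≤ t * ‖energyVec σ z‖) → s * ‖energyVec σ w‖ ≤ t)
    {w : Fin n → ℂ} (hw : w ∈ W) (h0 : ∀ z ∈ Z, ∑ j, star (z j) * (σ j * w j) = 0) :
    w = 0 := by
  have hσ0 : ∀ j, 0 ≤ σ j := fun j => (hσ j).le
  have energy_le : ∀ x, ‖energyVec σ x‖ ^ 2 ≤ ∑ j, ‖x j‖ ^ 2 := fun x => by
    rw [norm_energyVec_sq hσ0]
    exact Finset.sum_le_sum fun j _ => mul_le_of_le_one_left (by positivity) (hσ1 j)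
  set p : Fin n → ℂ := fun j => if j ≤ i then w j else 0 with hp
  have hp_high : ∀ j, i < j → p j = 0 := fun j hj => by simp [hp, hj]
  obtain ⟨w1, hw1, hw1p, hq⟩ := hW p hp_high
  -- The weight σ^(β−γ) gives both lift errors the same bound, as σ^(2γ)|p'|² = σ^(2β)|p|², and
  -- makes the form at (p, p') equal to `T` below.
  set p' : Fin n → ℂ := fun j => ((σ j ^ (β - γ) : ℝ) : ℂ) * p j with hp'
  have hp'_high : ∀ j, i < j → p' j = 0 := fun j hj => by simp [hp', hp_high j hj]
  obtain ⟨z1, hz1, hz1p, hq'⟩ := hZ p' hp'_high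
  set q := w1 - p with hqdef
  set q' := z1 - p' with hq'def
  set w2 := w - w1 with hw2def
  have hw2 : ∀ j ≤ i, w2 j = 0 := fun j hj => by simp [hw2def, hw1p j hj, hp, hj]
  have hq_low : ∀ j ≤ i, q j = 0 := fun j hj => by simp [hqdef, hw1p j hj]
  have hq'_low : ∀ j ≤ i, q' j = 0 := fun j hj => by simp [hq'def, hz1p j hj]
  have hwd : w = p + (q + w2) := by simp [hqdef, hw2def]
  set T : ℝ := ∑ j, σ j ^ (1 + β - γ) * ‖p j‖ ^ 2 with hT
  have hT0 : 0 ≤ T := Finset.sum_nonneg fun j _ => by have := hσ j; positivity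
  -- Split 2β = (β+γ−1) + (1+β−γ); the first exponent is nonnegative, so its power is largest at the
  -- index `i` among low indices.
  have hpow : ∑ j, σ j ^ (2 * β) * ‖p j‖ ^ 2 ≤ σ i ^ (β + γ - 1) * T := by
    rw [hT, Finset.mul_sum]
    refine Finset.sum_le_sum fun j _ => ?_
    rcases le_or_gt j i with hj | hj
    · rw [← mul_assoc]
      refine mul_le_mul_of_nonneg_right ?_ (by positivity)
      calc σ j ^ (2 * β) = σ j ^ (β + γ - 1) * σ j ^ (1 + β - γ) := by
            rw [← Real.rpow_add (hσ j)]; ring_nf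
        _ ≤ _ := by
            have h1 := hσ j
            have h2 := hmono hj
            gcongr
    · simp [hp_high j hj]
  have hpow' : ∑ j, σ j ^ (2 * γ) * ‖p' j‖ ^ 2 = ∑ j, σ j ^ (2 * β) * ‖p j‖ ^ 2 := by
    refine Finset.sum_congr rfl fun j _ => ?_
    rw [hp', norm_mul, mul_pow, Complex.norm_real, Real.norm_eq_abs, sq_abs, ← mul_assoc]
    congr 1
    rw [← Real.rpow_natCast, ← Real.rpow_mul (hσ0 j), ← Real.rpow_add (hσ j)]
    push_cast
    ring_nf
  rw [hpow'] at hq'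
  have hσβ : 0 ≤ σ i ^ (β + γ - 1) := Real.rpow_nonneg (hσ0 i) _
  have hq2 : ‖energyVec σ q‖ ^ 2 ≤ KP' * (σ i ^ (β + γ - 1) * T) :=
    (energy_le q).trans (hq.trans (by gcongr))
  have hq2' : ‖energyVec σ q'‖ ^ 2 ≤ KR' * (σ i ^ (β + γ - 1) * T) :=
    (energy_le q').trans (hq'.trans (by gcongr))
  have hqq : ‖energyVec σ q‖ * ‖energyVec σ q'‖ ≤ δ2 * T := by
    have hδ0 : 0 ≤ δ2 := by rw [hδ]; positivity
    refine (pow_le_pow_iff_left₀ (by positivity) (by positivity) two_ne_zero).1 ?_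
    calc (‖energyVec σ q‖ * ‖energyVec σ q'‖) ^ 2
        = ‖energyVec σ q‖ ^ 2 * ‖energyVec σ q'‖ ^ 2 := mul_pow _ _ _
      _ ≤ KP' * (σ i ^ (β + γ - 1) * T) * (KR' * (σ i ^ (β + γ - 1) * T)) := by gcongr
      _ = (δ2 * T) ^ 2 := by
        rw [hδ, ← Real.sqrt_eq_rpow, mul_pow, mul_pow, Real.sq_sqrt (by positivity)]
        ring
  have htest : ∀ z : Fin n → ℂ, (∀ j ≤ i, z j = 0) → ∑ j, star (z j) * (σ j * w j)
      = ∑ j, star (z j) * (σ j * (q + w2) j) := fun z hz => by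
    refine Finset.sum_congr rfl fun j _ => ?_
    rcases le_or_gt j i with hj | hj
    · simp [hz j hj]
    · rw [hwd, Pi.add_apply, hp_high j hj, zero_add]
  -- High test vectors do not see `p`, so on them `w2` and `-q` define the same functional.
  have hw2q : s * ‖energyVec σ w2‖ ≤ ‖energyVec σ q‖ := by
    refine hang w2 (W.sub_mem hw hw1) hw2 _ (norm_nonneg _) fun z hzZ hz => ?_
    have h1 := h0 z hzZ
    rw [htest z hz] at h1
    have h2 : ∑ j, star (z j) * (σ j * w2 j) = -∑ j, star (z j) * (σ j * q j) := by
      rw [eq_neg_iff_add_eq_zero, ← h1, ← Finset.sum_add_distrib]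
      refine Finset.sum_congr rfl fun j _ => ?_
      rw [Pi.add_apply]; ring
    rw [h2, norm_neg, mul_comm]
    exact norm_sum_star_mul_le hσ0 z q
  have hTle : T ≤ ‖energyVec σ q'‖ * (‖energyVec σ q‖ + ‖energyVec σ w2‖) := by
    have h1 := h0 z1 hz1
    have h2 : ∑ j, star (z1 j) * (σ j * w j) = (T : ℂ) + ∑ j, star (q' j) * (σ j * w j) := by
      rw [hT, Complex.ofReal_sum, ← Finset.sum_add_distrib]
      refine Finset.sum_congr rfl fun j _ => ?_
      have hz : z1 j = p' j + q' j := by simp [hq'def]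
      have hpw : star (p' j) * (σ j * w j) = ((σ j ^ (1 + β - γ) * ‖p j‖ ^ 2 : ℝ) : ℂ) := by
        rcases le_or_gt j i with hj | hj
        · have hwp : w j = p j := by simp [hp, hj]
          have h3 : σ j ^ (1 + β - γ) = σ j ^ (β - γ) * σ j := by
            rw [← Real.rpow_add_one (hσ j).ne']; ring_nf
          rw [hwp, hp', h3]
          simp only [star_mul', Complex.star_def, Complex.conj_ofReal]
          push_cast
          rw [← Complex.conj_mul']
          ring
        · simp [hp'_high j hj, hp_high j hj]
      rw [hz, star_add, add_mul, hpw]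
    rw [h1, htest q' hq'_low] at h2
    have h3 : T = ‖∑ j, star (q' j) * (σ j * (q + w2) j)‖ := by
      rw [← norm_neg, ← eq_neg_of_add_eq_zero_left h2.symm, Complex.norm_real,
        Real.norm_of_nonneg hT0]
    rw [h3]
    exact (norm_sum_star_mul_le hσ0 _ _).trans
      (mul_le_mul_of_nonneg_left (norm_energyVec_add_le _ _ _) (norm_nonneg _))
  have hδ0 : 0 ≤ δ2 := by rw [hδ]; positivity
  have hs1 : δ2 < s * (1 - δ2) := (div_lt_iff₀ (by linarith)).1 hs
  have hs0 : 0 < s := lt_of_le_of_lt (div_nonneg hδ0 (by linarith)) hs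
  -- If `T` were positive, the two tests would give s ≤ (s + 1)δ2, against δ2 < s(1 − δ2).
  have hT00 : T = 0 := by
    by_contra hne
    have hTpos : 0 < T := lt_of_le_of_ne hT0 (Ne.symm hne)
    have h1 : s * T ≤ (s + 1) * (δ2 * T) := calc
      s * T ≤ s * (‖energyVec σ q'‖ * (‖energyVec σ q‖ + ‖energyVec σ w2‖)) := by gcongr
      _ = ‖energyVec σ q'‖ * (s * ‖energyVec σ q‖ + s * ‖energyVec σ w2‖) := by ring
      _ ≤ ‖energyVec σ q'‖ * (s * ‖energyVec σ q‖ + ‖energyVec σ q‖) := by gcongr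
      _ = (s + 1) * (‖energyVec σ q‖ * ‖energyVec σ q'‖) := by ring
      _ ≤ _ := by gcongr
    nlinarith
  have hq0 : ‖energyVec σ q‖ = 0 := by
    rw [hT00, mul_zero, mul_zero] at hq2
    exact pow_eq_zero_iff two_ne_zero |>.1 (le_antisymm hq2 (sq_nonneg _))
  have hw20 : ‖energyVec σ w2‖ = 0 := by
    rw [hq0] at hw2q
    nlinarith [norm_nonneg (energyVec σ w2)]
  have hzero : ∀ x, ‖energyVec σ x‖ = 0 → x = 0 := fun x hx => by
    ext j
    have := congr_fun (congr_arg WithLp.ofLp (norm_eq_zero.1 hx)) j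
    simpa [energyVec, (Real.sqrt_pos.2 (hσ j)).ne'] using this
  have hp0 : p = 0 := by
    ext j
    have h1 := (Finset.sum_eq_zero_iff_of_nonneg (fun j _ => by
      have := hσ j; positivity)).1 (hT ▸ hT00) j (Finset.mem_univ j)
    have h2 := (Real.rpow_pos_of_pos (hσ j) (1 + β - γ)).ne'
    simpa [h2] using h1
  rw [hwd, hp0, hzero q hq0, hzero w2 hw20]
  simp

end InfSup

/-! ### Nonsingularity of the coarse operator -/

section CoarseNonsingular

variable {n m : ℕ}

theorem sqNorm_one_eq_zero {v : Fin n → ℂ} (h : sqNorm 1 v ≤ 0) : v = 0 := by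
  rw [sqNorm_one_eq_norm] at h
  have h1 : ‖WithLp.toLp 2 v‖ = 0 := by nlinarith [norm_nonneg (WithLp.toLp 2 v)]
  exact congr_arg WithLp.ofLp (norm_eq_zero.1 h1)

theorem SpecEquiv.mulVec_injective {P : Matrix (Fin n) (Fin m) ℂ} (h : SpecEquiv (Pᴴ * P) 1) :
    Function.Injective P.mulVec := by
  obtain ⟨a, b, ha, -, h⟩ := h
  refine (injective_iff_map_eq_zero P.mulVecLin).2 fun x hx => sqNorm_one_eq_zero ?_
  have hx : P *ᵥ x = 0 := hx
  have h1 := (h x).1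
  have h2 : sqNorm (Pᴴ * P) x = 0 := by rw [sqNorm, ← mulVec_mulVec, hx]; simp
  rw [h2] at h1
  exact nonpos_of_mul_nonpos_right h1 ha

/-- Tested on a right singular vector, the right-hand side is `K` times a positive power of its
singular value. -/
theorem FAP.const_nonneg {A : Matrix (Fin n) (Fin n) ℂ} {P : Matrix (Fin n) (Fin m) ℂ}
    {β η K : ℝ} (h : FAP (QA A) P β η K) (S : SVD A) (hA : IsUnit A.det)
    (hnorm : opNorm A = 1) (i : Fin n) : 0 ≤ K := by
  obtain ⟨vc, hvc⟩ := h (S.V *ᵥ Pi.single i 1)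
  rw [opNorm_QA, hnorm, Real.one_rpow, div_one, S.sqNorm_matPow_QA, S.sqNorm_matPow_QA,
    mulVec_mulVec, S.V_conj_mul, one_mulVec, Finset.sum_eq_single (a := i) (f := fun j =>
      S.σ j ^ (2 * β) * ‖(Pi.single i (1 : ℂ) : Fin n → ℂ) j‖ ^ 2)] at hvc
  · rw [Pi.single_eq_same, norm_one, one_pow, mul_one] at hvc
    refine nonneg_of_mul_nonneg_left (le_trans ?_ hvc) (Real.rpow_pos_of_pos (S.pos hA i) _)
    exact Finset.sum_nonneg fun j _ => mul_nonneg (Real.rpow_nonneg (S.nonneg j) _) (sq_nonneg _)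
  · intro j _ hj; simp [hj]
  · simp

/-- For η = 0 the property is Euclidean approximation with weights K σ_j^(2β), which are at most δ²
up to the index `i`. Lifting costs the factor 1/(1 − δ²), whence the hatted constants. -/
theorem FAP.exists_mem_range_eq_on_low {A : Matrix (Fin n) (Fin n) ℂ}
    {P : Matrix (Fin n) (Fin m) ℂ} {β K δ : ℝ} (h : FAP (QA A) P β 0 K) (S : SVD A)
    (hnorm : opNorm A = 1) (hβ : 0 ≤ β) (hK : 0 ≤ K) (i : Fin n)
    (hδ : δ = S.σ i ^ β * K ^ (1 / 2 : ℝ)) (hδ1 : δ < 1) (x : Fin n → ℂ)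
    (hx : ∀ j, i < j → x j = 0) :
    ∃ w ∈ LinearMap.range (S.Vᴴ * P).mulVecLin, (∀ j ≤ i, w j = x j) ∧
      ∑ j, ‖w j - x j‖ ^ 2 ≤ K / (1 - δ ^ 2) * ∑ j, S.σ j ^ (2 * β) * ‖x j‖ ^ 2 := by
  have hσ := Real.rpow_nonneg (S.nonneg i) β
  have hδ0 : 0 ≤ δ := by rw [hδ]; positivity
  have hδ2 : δ ^ 2 < 1 := by nlinarith
  obtain ⟨w, hw, hwx, hle⟩ := exists_mem_eq_on_low (LinearMap.range (S.Vᴴ * P).mulVecLin) i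
    (fun j => K * S.σ j ^ (2 * β)) (sq_nonneg δ) hδ2 (fun j hj => by
      have h1 : δ ^ 2 = K * S.σ i ^ (2 * β) := by
        rw [hδ, mul_pow, ← Real.sqrt_eq_rpow, Real.sq_sqrt hK, mul_comm 2 β,
          Real.rpow_mul (S.nonneg i)]
        norm_num [mul_comm]
      rw [h1]
      have := S.nonneg j
      have := S.mono hj
      gcongr) (fun v => by
      obtain ⟨vc, hvc⟩ := h (S.V *ᵥ v)
      rw [opNorm_QA, hnorm, Real.one_rpow, div_one, S.sqNorm_matPow_QA, S.sqNorm_matPow_QA,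
        mulVec_sub, mulVec_mulVec, S.V_conj_mul, one_mulVec, mulVec_mulVec, Finset.mul_sum] at hvc
      refine ⟨(S.Vᴴ * P) *ᵥ vc, ⟨vc, rfl⟩, ?_⟩
      simpa [mul_assoc] using hvc) hx
  refine ⟨w, hw, hwx, ?_⟩
  rw [div_mul_eq_mul_div, le_div_iff₀ (by linarith), mul_comm]
  refine hle.trans_eq ?_
  rw [Finset.mul_sum]
  simp only [mul_assoc]

theorem one_div_sqrt_two_lt_one : 1 / Real.sqrt 2 < 1 := by
  rw [div_lt_one (by positivity)]
  exact Real.lt_sqrt_of_sq_lt (by norm_num)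

theorem norm_energyVec_eq {A : Matrix (Fin n) (Fin n) ℂ} (S : SVD A) (v : Fin n → ℂ) :
    ‖energyVec S.σ (S.Vᴴ *ᵥ v)‖ ^ 2 = sqNorm (QA A) v := by
  rw [norm_energyVec_sq S.nonneg, S.sqNorm_QA]

theorem cosMaxAngle_mul_le {A : Matrix (Fin n) (Fin n) ℂ} {P R : Matrix (Fin n) (Fin m) ℂ}
    (S : SVD A) (i : Fin n) {w : Fin n → ℂ} (hw : w ∈ highPart S.V P i) {t : ℝ} (ht : 0 ≤ t)
    (h : ∀ z ∈ highPart S.U R i,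
      ‖star z ⬝ᵥ (A *ᵥ w)‖ ≤ t * ‖energyVec S.σ (S.Uᴴ *ᵥ z)‖) :
    cosMaxAngle A (highPart S.V P i) (highPart S.U R i) * ‖energyVec S.σ (S.Vᴴ *ᵥ w)‖ ≤ t := by
  set a := ‖energyVec S.σ (S.Vᴴ *ᵥ w)‖ with ha
  rcases (norm_nonneg (energyVec S.σ (S.Vᴴ *ᵥ w))).eq_or_lt with h0 | h0
  · rw [ha, ← h0, mul_zero]; exact ht
  rw [← ha] at h0
  rw [← le_div_iff₀ h0]
  obtain ⟨⟨c, hc⟩, hlow⟩ := hw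
  have hw' : ((a⁻¹ : ℝ) : ℂ) • w ∈ highPart S.V P i := by
    refine ⟨⟨((a⁻¹ : ℝ) : ℂ) • c, by rw [hc, mulVec_smul]⟩, fun j hj => ?_⟩
    rw [dotProduct_smul, hlow j hj, smul_zero]
  have hone : sqNorm (QA A) (((a⁻¹ : ℝ) : ℂ) • w) = 1 := by
    rw [S.sqNorm_QA, mulVec_smul]
    have h1 := norm_energyVec_sq S.nonneg (S.Vᴴ *ᵥ w)
    rw [← ha] at h1
    calc ∑ j, S.σ j * ‖(((a⁻¹ : ℝ) : ℂ) • (S.Vᴴ *ᵥ w)) j‖ ^ 2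
        = (a⁻¹) ^ 2 * ∑ j, S.σ j * ‖(S.Vᴴ *ᵥ w) j‖ ^ 2 := by
          rw [Finset.mul_sum]
          refine Finset.sum_congr rfl fun j _ => ?_
          rw [Pi.smul_apply, norm_smul, mul_pow, Complex.norm_real, Real.norm_eq_abs, sq_abs]
          ring
      _ = 1 := by rw [← h1, ← mul_pow, inv_mul_cancel₀ h0.ne', one_pow]
  refine (ciInf_le ⟨0, ?_⟩ ⟨((a⁻¹ : ℝ) : ℂ) • w, hw', hone⟩).trans ?_
  · rintro _ ⟨y, rfl⟩
    exact Real.iSup_nonneg fun z => norm_nonneg _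
  -- A real supremum over an empty family is 0, so the bound must also be known to be nonnegative.
  · refine Real.iSup_le (fun ⟨z, hz, hz1⟩ => ?_) (by positivity)
    have h2 := h z hz
    have h3 : ‖energyVec S.σ (S.Uᴴ *ᵥ z)‖ = 1 := by
      have h4 := norm_energyVec_eq S.adjoint z
      rw [← AQ_eq_QA_conjTranspose, hz1] at h4
      exact (pow_eq_one_iff_of_nonneg (norm_nonneg _) two_ne_zero).1 h4
    rw [h3, mul_one] at h2
    dsimp only
    rw [mulVec_smul, dotProduct_smul, norm_smul, Complex.norm_real, norm_inv,
      Real.norm_of_nonneg h0.le, inv_mul_le_iff₀ h0, mul_div_cancel₀ _ h0.ne']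
    exact h2

/-- A subspace that projects onto the first `i + 1` coordinates and has dimension at most `i + 1`
contains no nonzero vector orthogonal to them. -/
theorem eq_zero_of_low_eq_zero (B : Matrix (Fin n) (Fin m) ℂ) (i : Fin n) (hm : m ≤ i + 1)
    (h : ∀ x : Fin n → ℂ, (∀ j, i < j → x j = 0) →
      ∃ w ∈ LinearMap.range B.mulVecLin, ∀ j ≤ i, w j = x j)
    {w : Fin n → ℂ} (hw : w ∈ LinearMap.range B.mulVecLin) (h0 : ∀ j ≤ i, w j = 0) : w = 0 := by
  let φ : (Fin m → ℂ) →ₗ[ℂ] ({j : Fin n // j ≤ i} → ℂ) :=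
    (LinearMap.funLeft ℂ ℂ Subtype.val) ∘ₗ B.mulVecLin
  have hφ : Function.Surjective φ := fun y => by
    obtain ⟨w, ⟨c, rfl⟩, hc⟩ := h (fun j => if hj : j ≤ i then y ⟨j, hj⟩ else 0)
      (fun j hj => by simp [hj])
    refine ⟨c, funext fun j => ?_⟩
    have := hc j j.2
    simpa [φ, j.2] using this
  have hcard : Fintype.card {j : Fin n // j ≤ i} = i + 1 := by
    rw [Fintype.card_subtype, ← Fin.card_Iic]
    congr 1
    ext j; simp
  have hfin := LinearMap.finrank_le_finrank_of_surjective hφ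
  have hinj : Function.Injective φ := by
    refine (LinearMap.injective_iff_surjective_of_finrank_eq_finrank ?_).2 hφ
    refine le_antisymm ?_ hfin
    simp only [Module.finrank_fintype_fun_eq_card, Fintype.card_fin, hcard]
    exact hm
  obtain ⟨c, rfl⟩ := hw
  have : c = 0 := hinj (by rw [map_zero]; exact funext fun j => h0 j j.2)
  rw [this, map_zero]

theorem EquivIPConditions.isUnit_det {A : Matrix (Fin n) (Fin n) ℂ}
    {P R : Matrix (Fin n) (Fin m) ℂ} {β γ KP KR : ℝ}
    (h : EquivIPConditions A P R β γ KP KR) (hA : IsUnit A.det) (hnorm : opNorm A = 1) :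
    IsUnit (Rᴴ * A * P).det := by
  obtain ⟨hβ, hγ, hPP, hP, hRR, hR, S, i, δP, δR, KP', KR', δ2, him, hδP, hδP1, hKP', hδR, hδR1,
    hKR', hδ, hδ1, hang, -⟩ := h
  rw [AQ_eq_QA_conjTranspose] at hR
  have hA' : IsUnit Aᴴ.det := by rw [det_conjTranspose]; exact hA.star
  have hnorm' : opNorm Aᴴ = 1 := by
    rw [opNorm_conjTranspose, hnorm]
  have hKP := hP.const_nonneg S hA hnorm i
  have hKR := hR.const_nonneg S.adjoint hA' hnorm' i
  have hP1 := hδP1.trans one_div_sqrt_two_lt_one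
  have hR1 := hδR1.trans one_div_sqrt_two_lt_one
  have hW := hP.exists_mem_range_eq_on_low S hnorm (by linarith) hKP i hδP hP1
  have hZ := hR.exists_mem_range_eq_on_low S.adjoint hnorm' hγ.le hKR i hδR hR1
  rw [← hKP'] at hW
  rw [← hKR'] at hZ
  have nonneg_div : ∀ {K δ s : ℝ}, 0 ≤ K → 0 ≤ s → δ = s * K ^ (1 / 2 : ℝ) → δ < 1 →
      0 ≤ K / (1 - δ ^ 2) := fun {K δ s} hK hs hδ hδ1 => by
    have : 0 ≤ δ := by rw [hδ]; positivity
    exact div_nonneg hK (by nlinarith)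
  have hKP0 : 0 ≤ KP' := hKP' ▸ nonneg_div hKP (Real.rpow_nonneg (S.nonneg i) _) hδP hP1
  have hKR0 : 0 ≤ KR' := hKR' ▸ nonneg_div hKR (Real.rpow_nonneg (S.nonneg i) _) hδR hR1
  -- When k = n_c (here `m ≤ i + 1`) the range of `P` has no nonzero high vector, so the angle bound
  -- is vacuous and any large `s` serves.
  have key : ∃ s, δ2 / (1 - δ2) < s ∧ ∀ w ∈ LinearMap.range (S.Vᴴ * P).mulVecLin,
      (∀ j ≤ i, w j = 0) → ∀ t : ℝ, 0 ≤ t →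
      (∀ z ∈ LinearMap.range (S.Uᴴ * R).mulVecLin, (∀ j ≤ i, z j = 0) →
        ‖∑ j, star (z j) * (S.σ j * w j)‖ ≤ t * ‖energyVec S.σ z‖) →
      s * ‖energyVec S.σ w‖ ≤ t := by
    rcases Nat.lt_or_ge (i + 1) m with hlt | hge
    · refine ⟨_, hang hlt, ?_⟩
      rintro _ ⟨c, rfl⟩ hc t ht hz
      have e : ∀ (V : Matrix (Fin n) (Fin n) ℂ) (P : Matrix (Fin n) (Fin m) ℂ) (c : Fin m → ℂ),
          (Vᴴ * P).mulVecLin c = Vᴴ *ᵥ (P *ᵥ c) := fun V P c => by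
        rw [mulVecLin_apply, mulVec_mulVec]
      rw [e]
      refine cosMaxAngle_mul_le S i ⟨⟨c, rfl⟩, fun j hj => ?_⟩ ht ?_
      · have := hc j hj
        rwa [e] at this
      · rintro _ ⟨⟨d, rfl⟩, hd⟩
        rw [S.star_dotProduct_mulVec, ← e, ← e]
        exact hz _ ⟨d, rfl⟩ fun j hj => by rw [e]; exact hd j hj
    · refine ⟨δ2 / (1 - δ2) + 1, by linarith, fun w hw hw0 t ht _ => ?_⟩
      rw [eq_zero_of_low_eq_zero (S.Vᴴ * P) i hge (fun x hx => by
        obtain ⟨w, hw, hwx, -⟩ := hW x hx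
        exact ⟨w, hw, hwx⟩) hw hw0]
      rwa [energyVec_zero, norm_zero, mul_zero]
  obtain ⟨s, hs, hangle⟩ := key
  rw [← isUnit_iff_isUnit_det, ← mulVec_injective_iff_isUnit]
  refine (injective_iff_map_eq_zero (Rᴴ * A * P).mulVecLin).2 fun c hc => ?_
  have hc : (Rᴴ * A * P) *ᵥ c = 0 := hc
  have hw0 := eq_zero_of_forall_form_eq_zero S.σ (S.pos hA) S.mono
    (fun j => hnorm ▸ S.le_opNorm j) i _ _ (by linarith) hKP0 hKR0 hW hZ hδ hδ1 hs hangle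
    (w := (S.Vᴴ * P) *ᵥ c) ⟨c, rfl⟩ (by
      rintro _ ⟨d, rfl⟩
      have h1 : star (R *ᵥ d) ⬝ᵥ (A *ᵥ (P *ᵥ c)) = 0 := by
        rw [star_mulVec, ← dotProduct_mulVec, mulVec_mulVec, mulVec_mulVec, hc,
          dotProduct_zero]
      rw [S.star_dotProduct_mulVec, mulVec_mulVec, mulVec_mulVec] at h1
      exact h1)
  refine hPP.mulVec_injective ?_
  have h2 : S.V *ᵥ ((S.Vᴴ * P) *ᵥ c) = P *ᵥ c := by
    rw [mulVec_mulVec, ← Matrix.mul_assoc, S.V_mul_conj, Matrix.one_mul]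
  rw [mulVec_zero, ← h2, hw0, mulVec_zero]

end CoarseNonsingular

/-! ### Existence of constants; from norm to spectral equivalence -/

section Constants

variable {n m : ℕ}

theorem sqNorm_nonneg {M : Matrix (Fin n) (Fin n) ℂ} (hM : M.PosSemidef) (x : Fin n → ℂ) :
    0 ≤ sqNorm M x :=
  hM.re_dotProduct_nonneg x

theorem QA_posDef {A : Matrix (Fin n) (Fin n) ℂ} (hA : IsUnit A.det) : (QA A).PosDef := by
  rw [(QA_posSemidef A).posDef_iff_isUnit, isUnit_iff_isUnit_det]
  have h := congr_arg det (QA_mul_QA A)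
  rw [det_mul, det_mul, det_conjTranspose] at h
  exact isUnit_of_mul_isUnit_left (h ▸ hA.star.mul hA)

/-- Operator monotonicity of the square root. Let v be a unit eigenvector of N − cM with eigenvalue
λ < 0. Expanding ‖Nv‖² gives c²‖Mv‖² + λ(c⟨v,Mv⟩ + ⟨v,Nv⟩), so the hypothesis forces both
nonnegative terms in the bracket to vanish. But their difference ⟨v,Nv⟩ − c⟨v,Mv⟩ is λ. -/
theorem mul_sqNorm_le_of_sq_mul_sqNorm_one_le {M : Matrix (Fin n) (Fin n) ℂ} (hM : M.PosSemidef)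
    {N : Matrix (Fin n) (Fin n) ℂ} (hN : N.PosSemidef) {c : ℝ} (hc : 0 ≤ c)
    (h : ∀ x, c ^ 2 * sqNorm 1 (M *ᵥ x) ≤ sqNorm 1 (N *ᵥ x)) (x : Fin n → ℂ) :
    c * sqNorm M x ≤ sqNorm N x := by
  have hH : (N - (c : ℂ) • M).IsHermitian := by
    refine hN.1.sub ?_
    rw [IsHermitian, conjTranspose_smul, hM.1]
    simp
  have key : (N - (c : ℂ) • M).PosSemidef := by
    rw [hH.posSemidef_iff_eigenvalues_nonneg]
    intro i
    by_contra! hlam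
    rw [Pi.zero_apply] at hlam
    set lam := hH.eigenvalues i with hlamdef
    set v : Fin n → ℂ := (hH.eigenvectorBasis i).ofLp
    have hNv : N *ᵥ v = (c : ℂ) • (M *ᵥ v) + (lam : ℂ) • v := by
      have := hH.mulVec_eigenvectorBasis i
      rw [sub_mulVec, smul_mulVec, sub_eq_iff_eq_add'] at this
      exact this
    have hb : (star (N *ᵥ v) ⬝ᵥ v) = star v ⬝ᵥ (N *ᵥ v) := by
      rw [star_mulVec, hN.1, dotProduct_mulVec]
    have e1 : star (N *ᵥ v) ⬝ᵥ (N *ᵥ v)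
        = c * (star (N *ᵥ v) ⬝ᵥ (M *ᵥ v)) + lam * (star v ⬝ᵥ (N *ᵥ v)) := by
      conv_lhs => rw [hNv, dotProduct_add, dotProduct_smul, dotProduct_smul, ← hNv, hb]
      simp
    have e2 : star (N *ᵥ v) ⬝ᵥ (M *ᵥ v)
        = c * (star (M *ᵥ v) ⬝ᵥ (M *ᵥ v)) + lam * (star v ⬝ᵥ (M *ᵥ v)) := by
      rw [hNv, star_add, add_dotProduct, star_smul, star_smul, smul_dotProduct, smul_dotProduct]
      simp
    have e3 : star v ⬝ᵥ (N *ᵥ v)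
        = c * (star v ⬝ᵥ (M *ᵥ v)) + lam * (star v ⬝ᵥ v) := by
      rw [hNv, dotProduct_add, dotProduct_smul, dotProduct_smul]
      simp
    rw [e2] at e1
    have r1 := congr_arg Complex.re e1
    have r3 := congr_arg Complex.re e3
    have hx := h v
    have ha := sqNorm_nonneg hM v
    have hb0 := sqNorm_nonneg hN v
    simp only [sqNorm, one_mulVec] at hx ha hb0
    simp only [Complex.add_re, Complex.re_ofReal_mul] at r1 r3
    have hone : (star v ⬝ᵥ v).re = 1 := by
      have h1 := sqNorm_one_eq_norm v
      rw [sqNorm, one_mulVec] at h1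
      rw [h1]
      have : WithLp.toLp 2 v = hH.eigenvectorBasis i := rfl
      rw [this, hH.eigenvectorBasis.norm_eq_one, one_pow]
    rw [hone] at r3
    have hca := mul_nonneg hc ha
    nlinarith
  have h1 := sqNorm_nonneg key x
  simp only [sqNorm, sub_mulVec, dotProduct_sub, smul_mulVec, dotProduct_smul, Complex.sub_re,
    smul_eq_mul, Complex.re_ofReal_mul] at h1 ⊢
  linarith

theorem sqNorm_conj (M : Matrix (Fin n) (Fin n) ℂ) (P : Matrix (Fin n) (Fin m) ℂ)
    (x : Fin m → ℂ) : sqNorm (Pᴴ * M * P) x = sqNorm M (P *ᵥ x) := by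
  rw [sqNorm, sqNorm, star_mulVec, ← dotProduct_mulVec, mulVec_mulVec, mulVec_mulVec,
    Matrix.mul_assoc]

/-- Equivalence of the norms `‖M x‖` and `‖N x‖` implies spectral equivalence of `M` and `N`. -/
theorem NormEquivIP.specEquivIP {A : Matrix (Fin n) (Fin n) ℂ} {P R : Matrix (Fin n) (Fin m) ℂ}
    {c0 c1 : ℝ} (h0 : 0 < c0) (h1 : 0 < c1) (h : NormEquivIP A P R c0 c1) :
    SpecEquivIP A P R (Real.sqrt c0) (Real.sqrt c1) := by
  have hM : (Pᴴ * QA A * P).PosSemidef := (QA_posSemidef A).conjTranspose_mul_mul_same P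
  have hN := QA_posSemidef (Rᴴ * A * P)
  intro y
  rw [← sqNorm_conj]
  refine ⟨mul_sqNorm_le_of_sq_mul_sqNorm_one_le hM hN (Real.sqrt_nonneg _) (fun x => ?_) y, ?_⟩
  · rw [Real.sq_sqrt h0.le]; exact (h x).1
  · have hs := Real.sqrt_pos.2 h1
    rw [← inv_mul_le_iff₀ hs]
    refine mul_sqNorm_le_of_sq_mul_sqNorm_one_le hN hM (inv_nonneg.2 hs.le) (fun x => ?_) y
    rw [inv_pow, Real.sq_sqrt h1.le, inv_mul_le_iff₀ h1]
    exact (h x).2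

/-- Bound Mx = (MN⁻¹)Nx by the operator norm. The form "for all large C" lets finitely many levels
share one constant. -/
theorem eventually_sqNorm_one_mulVec_le (M : Matrix (Fin n) (Fin n) ℂ)
    {N : Matrix (Fin n) (Fin n) ℂ} (hN : IsUnit N.det) :
    ∀ᶠ C : ℝ in Filter.atTop, ∀ x, sqNorm 1 (M *ᵥ x) ≤ C * sqNorm 1 (N *ᵥ x) := by
  filter_upwards [Filter.eventually_ge_atTop (opNorm (M * N⁻¹) ^ 2)] with C hC x
  have h := sqNorm_one_mulVec_le (M * N⁻¹) (N *ᵥ x)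
  rw [mulVec_mulVec, nonsing_inv_mul_cancel_right _ _ hN] at h
  exact h.trans (mul_le_mul_of_nonneg_right hC (by rw [sqNorm_one]; positivity))

theorem eventually_normEquivIP {A : Matrix (Fin n) (Fin n) ℂ} {P R : Matrix (Fin n) (Fin m) ℂ}
    (hA : IsUnit A.det) (hP : Function.Injective P.mulVec) (hc : IsUnit (Rᴴ * A * P).det) :
    ∀ᶠ C : ℝ in Filter.atTop, NormEquivIP A P R C⁻¹ C := by
  have hM : IsUnit (Pᴴ * QA A * P).det :=
    ((isUnit_iff_isUnit_det _).1 ((QA_posDef hA).conjTranspose_mul_mul_same hP).isUnit)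
  have hN := (isUnit_iff_isUnit_det _).1 (QA_posDef hc).isUnit
  filter_upwards [eventually_sqNorm_one_mulVec_le (Pᴴ * QA A * P) hN,
    eventually_sqNorm_one_mulVec_le (QA (Rᴴ * A * P)) hM, Filter.eventually_gt_atTop 0]
    with C h1 h2 hC x
  exact ⟨(inv_mul_le_iff₀ hC).2 (h1 x), h2 x⟩

theorem eventually_stable {A : Matrix (Fin n) (Fin n) ℂ} (P R : Matrix (Fin n) (Fin m) ℂ)
    (hA : IsUnit A.det) : ∀ᶠ C : ℝ in Filter.atTop, Stable A P R C := by
  obtain ⟨B, hB⟩ : ∃ B : Matrix (Fin n) (Fin n) ℂ, QA A = Bᴴ * B := by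
    open scoped MatrixOrder in
    exact CStarAlgebra.nonneg_iff_eq_star_mul_self.mp (QA_posSemidef A).nonneg
  have hBdet : IsUnit B.det := by
    have h := (isUnit_iff_isUnit_det _).1 (QA_posDef hA).isUnit
    rw [hB, det_mul] at h
    exact isUnit_of_mul_isUnit_right h
  have hn : ∀ x, sqNorm (QA A) x = sqNorm 1 (B *ᵥ x) := fun x => by
    rw [← sqNorm_conj, Matrix.mul_one, hB]
  filter_upwards [eventually_sqNorm_one_mulVec_le (B * cgProj A P R) hBdet] with C h x
  rw [hn, hn, mulVec_mulVec]
  exact h x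

end Constants

/-! ### Perturbed coarse-grid correction and the scalar smoothing inequality -/

section TwoGrid

variable {n m : ℕ}

theorem sqNorm_add {M : Matrix (Fin n) (Fin n) ℂ} (hM : M.IsHermitian) (x y : Fin n → ℂ) :
    sqNorm M (x + y) = sqNorm M x + sqNorm M y + 2 * (star y ⬝ᵥ (M *ᵥ x)).re := by
  have h : (star x ⬝ᵥ (M *ᵥ y)).re = (star y ⬝ᵥ (M *ᵥ x)).re := by
    have : star x ⬝ᵥ (M *ᵥ y) = star (star y ⬝ᵥ (M *ᵥ x)) := by
      rw [← star_dotProduct, star_mulVec, hM, dotProduct_mulVec]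
    rw [this, Complex.star_def, Complex.conj_re]
  simp only [sqNorm, mulVec_add, star_add, add_dotProduct, dotProduct_add, Complex.add_re]
  linarith

theorem sqNorm_smul (M : Matrix (Fin n) (Fin n) ℂ) (t : ℝ) (x : Fin n → ℂ) :
    sqNorm M ((t : ℂ) • x) = t ^ 2 * sqNorm M x := by
  simp only [sqNorm, mulVec_smul, star_smul, smul_dotProduct, dotProduct_smul, smul_eq_mul,
    Complex.star_def, Complex.conj_ofReal, Complex.re_ofReal_mul]
  ring

theorem sqNorm_neg (M : Matrix (Fin n) (Fin n) ℂ) (x : Fin n → ℂ) :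
    sqNorm M (-x) = sqNorm M x := by
  simp [sqNorm, mulVec_neg]

theorem sqNorm_sub_le {M : Matrix (Fin n) (Fin n) ℂ} (hM : M.PosSemidef) (x y : Fin n → ℂ) :
    sqNorm M (x - y) ≤ 2 * sqNorm M x + 2 * sqNorm M y := by
  have h1 := sqNorm_add hM.1 x y
  have h2 := sqNorm_add hM.1 x (-y)
  have h3 := sqNorm_nonneg hM (x + y)
  rw [sqNorm_neg, star_neg, neg_dotProduct, Complex.neg_re, ← sub_eq_add_neg] at h2
  linarith

theorem cgProj_mulVec_mul {A : Matrix (Fin n) (Fin n) ℂ} {P R : Matrix (Fin n) (Fin m) ℂ}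
    (hc : IsUnit (Rᴴ * A * P).det) (c : Fin m → ℂ) :
    cgProj A P R *ᵥ (P *ᵥ c) = P *ᵥ c := by
  have : cgProj A P R * P = P * ((Rᴴ * A * P)⁻¹ * (Rᴴ * A * P)) := by
    simp only [cgProj, Matrix.mul_assoc]
  rw [mulVec_mulVec, this, nonsing_inv_mul _ hc, Matrix.mul_one]

theorem cgProj_mulVec (A : Matrix (Fin n) (Fin n) ℂ) (P R : Matrix (Fin n) (Fin m) ℂ)
    (x : Fin n → ℂ) :
    cgProj A P R *ᵥ x = P *ᵥ ((Rᴴ * A * P)⁻¹ *ᵥ (Rᴴ *ᵥ (A *ᵥ x))) := by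
  simp only [cgProj, mulVec_mulVec, Matrix.mul_assoc]

/-- A projection of squared norm at most `C` maps vectors orthogonal to its range with squared norm
at most `C - 1`. -/
theorem Stable.sqNorm_cgProj_le_of_orthogonal {A : Matrix (Fin n) (Fin n) ℂ}
    {P R : Matrix (Fin n) (Fin m) ℂ} {C : ℝ} (hst : Stable A P R C) (hC : 1 ≤ C)
    (hc : IsUnit (Rᴴ * A * P).det) {h : Fin n → ℂ}
    (horth : ∀ c, star (P *ᵥ c) ⬝ᵥ (QA A *ᵥ h) = 0) :
    sqNorm (QA A) (cgProj A P R *ᵥ h) ≤ (C - 1) * sqNorm (QA A) h := by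
  have hpos := QA_posSemidef A
  set p := sqNorm (QA A) (cgProj A P R *ᵥ h) with hp
  set q := sqNorm (QA A) h with hq
  have hp0 : 0 ≤ p := sqNorm_nonneg hpos _
  have hq0 : 0 ≤ q := sqNorm_nonneg hpos _
  -- Stability tested on h + tΠh: Π multiplies Πh by 1 + t in total, while orthogonality makes the
  -- energy of the argument q + t²p.
  have key : ∀ t : ℝ, (1 + t) ^ 2 * p ≤ C * (q + t ^ 2 * p) := by
    intro t
    have h1 := hst (h + (t : ℂ) • (cgProj A P R *ᵥ h))
    have e1 : cgProj A P R *ᵥ (h + (t : ℂ) • (cgProj A P R *ᵥ h))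
        = ((1 + t : ℝ) : ℂ) • (cgProj A P R *ᵥ h) := by
      rw [mulVec_add, mulVec_smul, cgProj_mulVec A P R h, cgProj_mulVec_mul hc]
      push_cast
      rw [add_smul, one_smul]
    have e2 : star ((t : ℂ) • (cgProj A P R *ᵥ h)) ⬝ᵥ (QA A *ᵥ h) = 0 := by
      rw [star_smul, smul_dotProduct, cgProj_mulVec, horth, smul_zero]
    rw [e1, sqNorm_smul, sqNorm_add hpos.1, e2, sqNorm_smul, Complex.zero_re, mul_zero,
      add_zero] at h1
    exact h1
  rcases hC.eq_or_lt with rfl | hC1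
  · rcases hp0.eq_or_lt with h0 | h0
    · rw [← h0]; simp
    · have h2 := key (q / p)
      have h3 : q / p * p = q := div_mul_cancel₀ q h0.ne'
      nlinarith
  -- This `t` maximizes (1 + t)² − Ct², the coefficient of p; the maximum is C/(C − 1).
  · have h2 := key (1 / (C - 1))
    have h4 : 0 < C - 1 := by linarith
    have h3 : (C - 1) ^ 2 * ((1 + 1 / (C - 1)) ^ 2 * p)
        ≤ (C - 1) ^ 2 * (C * (q + (1 / (C - 1)) ^ 2 * p)) := by gcongr
    have e1 : (C - 1) ^ 2 * ((1 + 1 / (C - 1)) ^ 2 * p) = C ^ 2 * p := by field_simp; ring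
    have e2 : (C - 1) ^ 2 * (C * (q + (1 / (C - 1)) ^ 2 * p)) = C * ((C - 1) ^ 2 * q + p) := by
      field_simp
    rw [e1, e2] at h3
    have h5 : C * ((C - 1) * p) ≤ C * ((C - 1) * ((C - 1) * q)) := by linarith
    exact le_of_mul_le_mul_left (le_of_mul_le_mul_left h5 (by linarith)) h4

/-- The error after a perturbed coarse-grid correction is controlled by the best approximation
from the range of `P` and by the perturbation. -/
theorem Stable.sqNorm_sub_cgProj_add_le {A : Matrix (Fin n) (Fin n) ℂ}
    {P R : Matrix (Fin n) (Fin m) ℂ} {C : ℝ} (hst : Stable A P R C) (hC : 1 ≤ C)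
    (hA : IsUnit A.det) (hP : Function.Injective P.mulVec)
    (hc : IsUnit (Rᴴ * A * P).det) (g : Fin n → ℂ) (y vc : Fin m → ℂ) :
    sqNorm (QA A) (g - cgProj A P R *ᵥ g + P *ᵥ y)
      ≤ (2 * C - 1) * sqNorm (QA A) (g - P *ᵥ vc) + 2 * sqNorm (QA A) (P *ᵥ y) := by
  have hpos := QA_posSemidef A
  have hM : IsUnit (Pᴴ * QA A * P).det :=
    ((isUnit_iff_isUnit_det _).1 ((QA_posDef hA).conjTranspose_mul_mul_same hP).isUnit)
  set c0 := (Pᴴ * QA A * P)⁻¹ *ᵥ (Pᴴ *ᵥ (QA A *ᵥ g)) with hc0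
  set h := g - P *ᵥ c0 with hh
  have horth : ∀ c, star (P *ᵥ c) ⬝ᵥ (QA A *ᵥ h) = 0 := by
    intro c
    have : Pᴴ *ᵥ (QA A *ᵥ h) = 0 := by
      rw [hh, mulVec_sub, mulVec_sub, sub_eq_zero]
      conv_rhs => rw [mulVec_mulVec, mulVec_mulVec, hc0, mulVec_mulVec, mul_nonsing_inv _ hM,
        one_mulVec]
    rw [star_mulVec, ← dotProduct_mulVec, this, dotProduct_zero]
  have hmin : sqNorm (QA A) h ≤ sqNorm (QA A) (g - P *ᵥ vc) := by
    have e : g - P *ᵥ vc = h + P *ᵥ (c0 - vc) := by rw [hh, mulVec_sub]; abel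
    rw [e, sqNorm_add hpos.1, horth, Complex.zero_re, mul_zero, add_zero]
    linarith [sqNorm_nonneg hpos (P *ᵥ (c0 - vc))]
  have hproj := hst.sqNorm_cgProj_le_of_orthogonal hC hc horth
  have hsub := sqNorm_sub_le hpos (P *ᵥ y) (cgProj A P R *ᵥ h)
  have e : g - cgProj A P R *ᵥ g + P *ᵥ y = h + (P *ᵥ y - cgProj A P R *ᵥ h) := by
    have hg : g = h + P *ᵥ c0 := by rw [hh]; abel
    have h2 : cgProj A P R *ᵥ g = cgProj A P R *ᵥ h + P *ᵥ c0 := by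
      conv_lhs => rw [hg, mulVec_add, cgProj_mulVec_mul hc]
    rw [h2, hh]; abel
  -- The whole correction lies in the range of `P`, so Pythagoras applies; this gives the constant 1
  -- + 2(C − 1) = 2C − 1.
  have horth' : star (P *ᵥ y - cgProj A P R *ᵥ h) ⬝ᵥ (QA A *ᵥ h) = 0 := by
    rw [cgProj_mulVec, ← mulVec_sub, horth]
  rw [e, sqNorm_add hpos.1, horth', Complex.zero_re, mul_zero, add_zero]
  have h3 : (2 * C - 1) * sqNorm (QA A) h ≤ (2 * C - 1) * sqNorm (QA A) (g - P *ᵥ vc) :=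
    mul_le_mul_of_nonneg_left hmin (by linarith)
  linarith

/-- The left side is (s e^(−s))^α + ½(e^(−s))^α with both bases in [0, 1], hence decreasing in α. At
α = 1/2 it follows from √s + 1/2 ≤ 1 + s/2 ≤ e^(s/2). -/
theorem rpow_add_half_mul_exp_le_one {α s : ℝ} (hα : 1 / 2 ≤ α) (hs : 0 ≤ s) :
    (s ^ α + 1 / 2) * Real.exp (-(α * s)) ≤ 1 := by
  have e : ∀ a : ℝ, (s ^ a + 1 / 2) * Real.exp (-(a * s))
      = (s * Real.exp (-s)) ^ a + 1 / 2 * Real.exp (-s) ^ a := fun a => by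
    have : Real.exp (-(a * s)) = Real.exp (-s) ^ a := by rw [← Real.exp_mul]; ring_nf
    rw [this, Real.mul_rpow hs (Real.exp_pos _).le, add_mul]
  have h0 : 0 ≤ s * Real.exp (-s) := mul_nonneg hs (Real.exp_pos _).le
  have h1 : s * Real.exp (-s) ≤ 1 := by
    rw [Real.exp_neg, ← div_eq_mul_inv, div_le_one (Real.exp_pos _)]
    linarith [Real.add_one_le_exp s]
  have h2 : Real.exp (-s) ≤ 1 := Real.exp_le_one_iff.2 (by linarith)
  calc (s ^ α + 1 / 2) * Real.exp (-(α * s))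
      ≤ (s ^ (1 / 2 : ℝ) + 1 / 2) * Real.exp (-(1 / 2 * s)) := by
        rw [e, e]
        have := Real.rpow_le_rpow_of_exponent_ge' h0 h1 (by norm_num) hα
        have := Real.rpow_le_rpow_of_exponent_ge (Real.exp_pos (-s)) h2 hα
        linarith
    _ ≤ 1 := by
        rw [Real.exp_neg, ← div_eq_mul_inv, div_le_one (Real.exp_pos _), ← Real.sqrt_eq_rpow]
        have h3 := Real.add_one_le_exp (1 / 2 * s)
        have h4 := Real.sq_sqrt hs
        nlinarith [sq_nonneg (Real.sqrt s - 1)]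

/-- Put s = X^(1/α) t in the preceding inequality and use (1 − t)^(2ν) ≤ e^(−2νt); the bound on ν
says exactly that 2ν ≥ αX^(1/α). -/
theorem mul_rpow_add_half_mul_one_sub_pow_le_one {α X t : ℝ} {ν : ℕ} (hα : 1 / 2 ≤ α)
    (hX : 0 ≤ X) (hν : α / 2 * X ^ (1 / α) ≤ ν) (ht0 : 0 ≤ t) (ht1 : t ≤ 1) :
    (X * t ^ α + 1 / 2) * (1 - t) ^ (2 * ν) ≤ 1 := by
  have hα0 : 0 < α := by linarith
  have hXa : (X ^ (1 / α)) ^ α = X := by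
    rw [← Real.rpow_mul hX, one_div_mul_cancel hα0.ne', Real.rpow_one]
  have hXn : 0 ≤ X ^ (1 / α) := Real.rpow_nonneg hX _
  have h1 : (1 - t) ^ (2 * ν) ≤ Real.exp (-(α * (X ^ (1 / α) * t))) := by
    calc (1 - t) ^ (2 * ν) ≤ Real.exp (-t) ^ (2 * ν) := by
          have := Real.one_sub_le_exp_neg t
          have : 0 ≤ 1 - t := by linarith
          gcongr
      _ = Real.exp (-(2 * ν * t)) := by rw [← Real.exp_nat_mul]; push_cast; ring_nf
      _ ≤ _ := by
          apply Real.exp_le_exp.2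
          nlinarith
  have h2 := rpow_add_half_mul_exp_le_one hα (mul_nonneg hXn ht0)
  rw [Real.mul_rpow hXn ht0, hXa] at h2
  refine le_trans ?_ h2
  gcongr

end TwoGrid

/-! ### Smoothing and one level of the W-cycle -/

section WCycle

variable {n m : ℕ}

theorem sub_richardson {A : Matrix (Fin n) (Fin n) ℂ} (hnorm : opNorm A = 1)
    (xs x : Fin n → ℂ) :
    xs - richardson A (A *ᵥ xs) x = (xs - x) - (Aᴴ * A) *ᵥ (xs - x) := by
  rw [richardson, hnorm, ← mulVec_sub, mulVec_mulVec]
  simp only [one_pow, div_one, Complex.ofReal_one, one_smul]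
  abel

theorem SVD.mulVec_sub_iterate_richardson {A : Matrix (Fin n) (Fin n) ℂ} (S : SVD A)
    (hnorm : opNorm A = 1) (xs x : Fin n → ℂ) (ν : ℕ) (j : Fin n) :
    (S.Vᴴ *ᵥ (xs - (richardson A (A *ᵥ xs))^[ν] x)) j
      = (((1 - S.σ j ^ 2) ^ ν : ℝ) : ℂ) * (S.Vᴴ *ᵥ (xs - x)) j := by
  induction ν with
  | zero => simp
  | succ k ih =>
    have h : ∀ v : Fin n → ℂ, (S.Vᴴ *ᵥ (v - (Aᴴ * A) *ᵥ v)) j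
        = ((1 - S.σ j ^ 2 : ℝ) : ℂ) * (S.Vᴴ *ᵥ v) j := fun v => by
      rw [S.conjTranspose_mul_self, unitaryDiagonal_apply, mulVec_sub, mulVec_mulVec,
        ← Matrix.mul_assoc, ← Matrix.mul_assoc, S.V_conj_mul, Matrix.one_mul, ← mulVec_mulVec,
        Pi.sub_apply, mulVec_diagonal]
      push_cast
      simp [sub_mul]
    rw [Function.iterate_succ_apply', sub_richardson hnorm, h, ih, ← mul_assoc,
      ← Complex.ofReal_mul, ← pow_succ']

/-- The scalar inequality with t = σ_j² and α = (2β − 1)/2, mode by mode; β ≥ 1 gives α ≥ 1/2. The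
term with factor 1/2 is reserved for the inexact coarse solve. -/
theorem SVD.smoothing_bound {A : Matrix (Fin n) (Fin n) ℂ} (S : SVD A) (hA : IsUnit A.det)
    (hnorm : opNorm A = 1) {β X : ℝ} (hβ : 1 ≤ β) (hX : 0 ≤ X) {ν : ℕ}
    (hν : (2 * β - 1) / 4 * X ^ (2 / (2 * β - 1)) ≤ ν) (xs x : Fin n → ℂ) :
    X * sqNorm (matPow (QA A) (2 * β)) (xs - (richardson A (A *ᵥ xs))^[ν] x)
      + 1 / 2 * sqNorm (QA A) (xs - (richardson A (A *ᵥ xs))^[ν] x)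
      ≤ sqNorm (QA A) (xs - x) := by
  rw [S.sqNorm_matPow_QA, S.sqNorm_QA, S.sqNorm_QA, Finset.mul_sum, Finset.mul_sum,
    ← Finset.sum_add_distrib]
  refine Finset.sum_le_sum fun j _ => ?_
  have hσ := S.pos hA j
  have hσ1 : S.σ j ≤ 1 := hnorm ▸ S.le_opNorm j
  have hα : (1 : ℝ) / 2 ≤ (2 * β - 1) / 2 := by linarith
  have h1 := mul_rpow_add_half_mul_one_sub_pow_le_one (t := S.σ j ^ 2) (ν := ν) hα hX
    (by
      have : (2 * β - 1) / 2 / 2 * X ^ (1 / ((2 * β - 1) / 2))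
          = (2 * β - 1) / 4 * X ^ (2 / (2 * β - 1)) := by
        rw [one_div_div]; ring
      rwa [this]) (by positivity) (by nlinarith)
  have h2 : (S.σ j ^ 2) ^ ((2 * β - 1) / 2) = S.σ j ^ (2 * β - 1) := by
    rw [← Real.rpow_natCast, ← Real.rpow_mul hσ.le]
    congr 1
    push_cast; ring
  have h3 : S.σ j ^ (2 * β) = S.σ j ^ (2 * β - 1) * S.σ j := by
    rw [← Real.rpow_add_one hσ.ne']; ring_nf
  rw [h2] at h1
  rw [S.mulVec_sub_iterate_richardson hnorm, norm_mul, mul_pow, Complex.norm_real,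
    Real.norm_eq_abs, sq_abs, ← pow_mul, mul_comm ν 2, h3]
  calc _ = (X * S.σ j ^ (2 * β - 1) + 1 / 2) * (1 - S.σ j ^ 2) ^ (2 * ν)
        * (S.σ j * ‖(S.Vᴴ *ᵥ (xs - x)) j‖ ^ 2) := by ring
    _ ≤ 1 * (S.σ j * ‖(S.Vᴴ *ᵥ (xs - x)) j‖ ^ 2) := by gcongr
    _ = _ := one_mul _

/-- Singular values are at most 1, so the energy is at most the Euclidean square norm: FAP(β, 0)
implies FAP(β, 1) with the same constant. -/
theorem FAP.exists_sqNorm_QA_le_of_zero {A : Matrix (Fin n) (Fin n) ℂ}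
    {P : Matrix (Fin n) (Fin m) ℂ} {β K K' : ℝ} (h : FAP (QA A) P β 0 K) (S : SVD A)
    (hnorm : opNorm A = 1) (hK : K ≤ K') (v : Fin n → ℂ) :
    ∃ vc, sqNorm (QA A) (v - P *ᵥ vc) ≤ K' * sqNorm (matPow (QA A) (2 * β)) v := by
  obtain ⟨vc, hvc⟩ := h v
  rw [opNorm_QA, hnorm, Real.one_rpow, div_one] at hvc
  refine ⟨vc, le_trans ?_ (hvc.trans (mul_le_mul_of_nonneg_right hK ?_))⟩
  · rw [S.sqNorm_matPow_QA, S.sqNorm_QA]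
    refine Finset.sum_le_sum fun j _ => ?_
    rw [Real.rpow_zero]
    exact mul_le_mul_of_nonneg_right (hnorm ▸ S.le_opNorm j) (sq_nonneg _)
  · rw [S.sqNorm_matPow_QA]
    exact Finset.sum_nonneg fun j _ => mul_nonneg (Real.rpow_nonneg (S.nonneg j) _) (sq_nonneg _)

theorem FAP.exists_sqNorm_QA_le_of_one {A : Matrix (Fin n) (Fin n) ℂ}
    {P : Matrix (Fin n) (Fin m) ℂ} {β K : ℝ} (h : FAP (QA A) P β 1 K) (S : SVD A)
    (hnorm : opNorm A = 1) (v : Fin n → ℂ) :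
    ∃ vc, sqNorm (QA A) (v - P *ᵥ vc) ≤ K * sqNorm (matPow (QA A) (2 * β)) v := by
  obtain ⟨vc, hvc⟩ := h v
  rw [opNorm_QA, hnorm, Real.one_rpow, div_one, S.sqNorm_matPow_QA] at hvc
  refine ⟨vc, ?_⟩
  rw [S.sqNorm_QA]
  simpa only [Real.rpow_one] using hvc

/-- One level of the W-cycle: if two coarse cycles reduce the squared energy of the coarse error by
`ρ ^ 2`, the whole cycle reduces that of the fine error by `ρ`. -/
theorem sqNorm_wcycle_step_le {A : Matrix (Fin n) (Fin n) ℂ} {P R : Matrix (Fin n) (Fin m) ℂ}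
    (S : SVD A) (hA : IsUnit A.det) (hnorm : opNorm A = 1) (hP : Function.Injective P.mulVec)
    (hc : IsUnit (Rᴴ * A * P).det) {β K Cs r a b ρ : ℝ} (hβ : 1 ≤ β) (hK : 0 ≤ K) (hCs : 1 ≤ Cs)
    (ha : 0 < a) (hb : 0 < b) (hr : b / a ≤ r) (hρ : ρ = 1 / (2 * (2 * r * Cs)))
    (hfap : ∀ v, ∃ vc, sqNorm (QA A) (v - P *ᵥ vc) ≤ K * sqNorm (matPow (QA A) (2 * β)) v)
    (hspec : SpecEquivIP A P R a b) (hst : Stable A P R Cs) {ν : ℕ}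
    (hν : (2 * β - 1) / 4 * (4 * r * K * Cs * (2 * Cs - 1)) ^ (2 / (2 * β - 1)) ≤ ν)
    (xs x : Fin n → ℂ) (xc : Fin m → ℂ)
    (hxc : sqNorm (QA (Rᴴ * A * P))
        ((Rᴴ * A * P)⁻¹ *ᵥ (Rᴴ *ᵥ (A *ᵥ (xs - (richardson A (A *ᵥ xs))^[ν] x))) - xc)
      ≤ ρ ^ 2 * sqNorm (QA (Rᴴ * A * P))
        ((Rᴴ * A * P)⁻¹ *ᵥ (Rᴴ *ᵥ (A *ᵥ (xs - (richardson A (A *ᵥ xs))^[ν] x))))) :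
    sqNorm (QA A) (xs - ((richardson A (A *ᵥ xs))^[ν] x + P *ᵥ xc))
      ≤ ρ * sqNorm (QA A) (xs - x) := by
  have hr0 : 0 < r := (div_pos hb ha).trans_le hr
  have hX : 0 ≤ 4 * r * K * Cs * (2 * Cs - 1) := by
    have : 0 ≤ 2 * Cs - 1 := by linarith
    positivity
  have hsm := S.smoothing_bound hA hnorm hβ hX hν xs x
  set g := xs - (richardson A (A *ᵥ xs))^[ν] x with hg
  set ec := (Rᴴ * A * P)⁻¹ *ᵥ (Rᴴ *ᵥ (A *ᵥ g)) with hec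
  obtain ⟨vc, hvc⟩ := hfap g
  have hproj : cgProj A P R *ᵥ g = P *ᵥ ec := cgProj_mulVec A P R g
  have e : xs - ((richardson A (A *ᵥ xs))^[ν] x + P *ᵥ xc)
      = g - cgProj A P R *ᵥ g + P *ᵥ (ec - xc) := by
    rw [hproj, mulVec_sub, hg]; abel
  rw [e]
  have h1 := hst.sqNorm_sub_cgProj_add_le hCs hA hP hc g (ec - xc) vc
  have h2 := hst g
  rw [hproj] at h2
  have hg0 := sqNorm_nonneg (QA_posSemidef A) g
  -- Pass to the coarse norm, use the two coarse cycles, return to the fine norm, and apply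
  -- stability to P ec = Πg.
  have h3 : a * sqNorm (QA A) (P *ᵥ (ec - xc)) ≤ ρ ^ 2 * (b * (Cs * sqNorm (QA A) g)) :=
    (hspec _).1.trans (hxc.trans (mul_le_mul_of_nonneg_left
      ((hspec ec).2.trans (mul_le_mul_of_nonneg_left h2 hb.le)) (sq_nonneg ρ)))
  have h4 : sqNorm (QA A) (P *ᵥ (ec - xc)) ≤ ρ ^ 2 * (r * (Cs * sqNorm (QA A) g)) := by
    calc _ ≤ (ρ ^ 2 * (b * (Cs * sqNorm (QA A) g))) / a := by rwa [le_div_iff₀' ha]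
      _ = ρ ^ 2 * (b / a * (Cs * sqNorm (QA A) g)) := by ring
      _ ≤ _ := by gcongr
  have hρ0 : 0 < ρ := by rw [hρ]; positivity
  -- This identity fixes ρ: it turns the ρ² of the coarse cycles into ρ/2 in `h5` and matches the
  -- approximation term with the smoothing constant in `h6`.
  have hρr : ρ * (4 * r * Cs) = 1 := by rw [hρ]; field_simp; norm_num
  have h5 : 2 * (ρ ^ 2 * (r * (Cs * sqNorm (QA A) g))) = ρ * (1 / 2 * sqNorm (QA A) g) := by
    calc _ = ρ * (ρ * (4 * r * Cs)) * (1 / 2 * sqNorm (QA A) g) := by ring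
      _ = _ := by rw [hρr, mul_one]
  have h6 : (2 * Cs - 1) * (K * sqNorm (matPow (QA A) (2 * β)) g)
      = ρ * (4 * r * K * Cs * (2 * Cs - 1) * sqNorm (matPow (QA A) (2 * β)) g) := by
    calc _ = 1 * ((2 * Cs - 1) * (K * sqNorm (matPow (QA A) (2 * β)) g)) := (one_mul _).symm
      _ = _ := by rw [← hρr]; ring
  have h7 : (2 * Cs - 1) * sqNorm (QA A) (g - P *ᵥ vc)
      ≤ (2 * Cs - 1) * (K * sqNorm (matPow (QA A) (2 * β)) g) :=
    mul_le_mul_of_nonneg_left hvc (by linarith)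
  have h8 := mul_le_mul_of_nonneg_left hsm hρ0.le
  linarith

theorem sqrt_div_sqrt_le {c0 c1 : ℝ} (h0 : 0 < c0) (h : c0 ≤ c1) :
    Real.sqrt c1 / Real.sqrt c0 ≤ c1 / c0 := by
  rw [← Real.sqrt_div' _ h0.le]
  exact Real.sqrt_le_self_iff.2 (Or.inr ((one_le_div h0).2 h))

theorem EquivIPConditions.exists_svd {A : Matrix (Fin n) (Fin n) ℂ}
    {P R : Matrix (Fin n) (Fin m) ℂ} {β γ KP KR : ℝ} (h : EquivIPConditions A P R β γ KP KR) :
    ∃ _ : SVD A, Nonempty (Fin n) := by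
  obtain ⟨-, -, -, -, -, -, S, i, -⟩ := h
  exact ⟨S, ⟨i⟩⟩

end WCycle

end AMG

/-! ### Assembly over the hierarchy -/

theorem theorem3p3 (H : AMG.Hierarchy) (β : ℝ) (γ KP KR : ℕ → ℝ)
    (hA : IsUnit (H.A 0).det)
    (hnorm : ∀ ℓ, ℓ < H.L → AMG.opNorm (H.A ℓ) = 1)
    (hdim : ∀ ℓ, ℓ + 1 < H.L → H.dim (ℓ + 1) < H.dim ℓ)
    (hlem : ∀ ℓ, ℓ + 1 < H.L →
      AMG.EquivIPConditions (H.A ℓ) (H.P ℓ) (H.R ℓ) β (γ ℓ) (KP ℓ) (KR ℓ)) :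
    -- every operator of the hierarchy is nonsingular and the constants exist
    (∀ ℓ, ℓ < H.L → IsUnit (H.A ℓ).det) ∧
    (∃ c0 c1 : ℝ, 0 < c0 ∧ c0 ≤ c1 ∧
      ∀ ℓ, ℓ + 1 < H.L → AMG.NormEquivIP (H.A ℓ) (H.P ℓ) (H.R ℓ) c0 c1) ∧
    (∃ Cs : ℝ, 1 ≤ Cs ∧ ∀ ℓ, ℓ + 1 < H.L → AMG.Stable (H.A ℓ) (H.P ℓ) (H.R ℓ) Cs) ∧
    -- W-cycle convergence, for all constants valid on all levels
    (∀ c0 c1 K Cs : ℝ, 0 < c0 → c0 ≤ c1 → 1 ≤ Cs →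
      ((∀ ℓ, ℓ + 1 < H.L → AMG.NormEquivIP (H.A ℓ) (H.P ℓ) (H.R ℓ) c0 c1) ∨
        (∀ ℓ, ℓ + 1 < H.L → AMG.SpecEquivIP (H.A ℓ) (H.P ℓ) (H.R ℓ) c0 c1)) →
      ((∀ ℓ, ℓ + 1 < H.L → KP ℓ ≤ K) ∨
        (∀ ℓ, ℓ + 1 < H.L → AMG.FAP (AMG.QA (H.A ℓ)) (H.P ℓ) β 1 K)) →
      (∀ ℓ, ℓ + 1 < H.L → AMG.Stable (H.A ℓ) (H.P ℓ) (H.R ℓ) Cs) →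
      ∀ ν : ℕ,
        (2 * β - 1) / 4 * (4 * (c1 / c0) * K * Cs * (2 * Cs - 1)) ^ (2 / (2 * β - 1)) ≤ (ν : ℝ) →
        1 / (2 * (2 * (c1 / c0) * Cs)) < 1 ∧
        ∀ d ℓ : ℕ, ℓ + d + 1 = H.L → ∀ b x xs : Fin (H.dim ℓ) → ℂ, (H.A ℓ).mulVec xs = b →
          AMG.sqNorm (AMG.QA (H.A ℓ)) (xs - H.wcycle ν d ℓ b x)
            ≤ 1 / (2 * (2 * (c1 / c0) * Cs)) * AMG.sqNorm (AMG.QA (H.A ℓ)) (xs - x)) := by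
  have hns : ∀ ℓ, ℓ < H.L → IsUnit (H.A ℓ).det := by
    intro ℓ
    induction ℓ with
    | zero => exact fun _ => hA
    | succ ℓ ih => exact fun hℓ => (hlem ℓ hℓ).isUnit_det (ih (by omega)) (hnorm ℓ (by omega))
  have hinj : ∀ ℓ, ℓ + 1 < H.L → Function.Injective (H.P ℓ).mulVec :=
    fun ℓ hℓ => (hlem ℓ hℓ).2.2.1.mulVec_injective
  refine ⟨hns, ?_, ?_, ?_⟩
  · have h : ∀ᶠ C : ℝ in Filter.atTop, ∀ ℓ ∈ Finset.range (H.L - 1),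
        AMG.NormEquivIP (H.A ℓ) (H.P ℓ) (H.R ℓ) C⁻¹ C := by
      rw [Filter.eventually_all_finset]
      intro ℓ hℓ
      have hℓ : ℓ + 1 < H.L := by rw [Finset.mem_range] at hℓ; omega
      exact AMG.eventually_normEquivIP (hns ℓ (by omega)) (hinj ℓ hℓ) (hns (ℓ + 1) hℓ)
    obtain ⟨C, hC, hC1⟩ := (h.and (Filter.eventually_ge_atTop 1)).exists
    exact ⟨C⁻¹, C, by positivity, (inv_le_one_of_one_le₀ hC1).trans hC1,
      fun ℓ hℓ => hC ℓ (Finset.mem_range.2 (by omega))⟩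
  · have h : ∀ᶠ C : ℝ in Filter.atTop, ∀ ℓ ∈ Finset.range (H.L - 1),
        AMG.Stable (H.A ℓ) (H.P ℓ) (H.R ℓ) C := by
      rw [Filter.eventually_all_finset]
      intro ℓ hℓ
      have hℓ : ℓ + 1 < H.L := by rw [Finset.mem_range] at hℓ; omega
      exact AMG.eventually_stable _ _ (hns ℓ (by omega))
    obtain ⟨C, hC, hC1⟩ := (h.and (Filter.eventually_ge_atTop 1)).exists
    exact ⟨C, hC1, fun ℓ hℓ => hC ℓ (Finset.mem_range.2 (by omega))⟩
  · intro c0 c1 K Cs h0 h01 hCs hequiv hK hst ν hν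
    have h1 : 0 < c1 := h0.trans_le h01
    have hr1 : 1 ≤ c1 / c0 := (one_le_div h0).2 h01
    have hρ0 : 0 ≤ 1 / (2 * (2 * (c1 / c0) * Cs)) := by positivity
    -- Norm equivalence yields spectral equivalence with the square roots of the constants; their
    -- ratio only improves since c1/c0 ≥ 1.
    have hspec : ∃ a b : ℝ, 0 < a ∧ 0 < b ∧ b / a ≤ c1 / c0 ∧
        ∀ ℓ, ℓ + 1 < H.L → AMG.SpecEquivIP (H.A ℓ) (H.P ℓ) (H.R ℓ) a b := by
      rcases hequiv with h | h
      · exact ⟨_, _, Real.sqrt_pos.2 h0, Real.sqrt_pos.2 h1, AMG.sqrt_div_sqrt_le h0 h01,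
          fun ℓ hℓ => (h ℓ hℓ).specEquivIP h0 h1⟩
      · exact ⟨c0, c1, h0, h1, le_rfl, h⟩
    obtain ⟨a, b, ha, hb, hab, hspec⟩ := hspec
    refine ⟨by rw [div_lt_one (by positivity)]; nlinarith, fun d => ?_⟩
    induction d with
    | zero =>
      rintro ℓ hℓ _ x xs rfl
      have e : H.wcycle ν 0 ℓ ((H.A ℓ).mulVec xs) x = xs := by
        rw [AMG.Hierarchy.wcycle, Matrix.mulVec_mulVec,
          Matrix.nonsing_inv_mul _ (hns ℓ (by omega)), Matrix.one_mulVec]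
      rw [e, sub_self]
      refine le_trans (le_of_eq ?_)
        (mul_nonneg hρ0 (AMG.sqNorm_nonneg (AMG.QA_posSemidef (H.A ℓ)) (xs - x)))
      simp [AMG.sqNorm]
    | succ d ih =>
      rintro ℓ hℓ _ x xs rfl
      have hℓ' : ℓ + 1 < H.L := by omega
      have hlev := hlem ℓ hℓ'
      obtain ⟨S, ⟨i⟩⟩ := hlev.exists_svd
      have hAℓ := hns ℓ (by omega)
      have hnℓ := hnorm ℓ (by omega)
      have hfap : 0 ≤ K ∧ ∀ v, ∃ vc, AMG.sqNorm (AMG.QA (H.A ℓ)) (v - (H.P ℓ).mulVec vc)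
          ≤ K * AMG.sqNorm (AMG.matPow (AMG.QA (H.A ℓ)) (2 * β)) v := by
        rcases hK with h | h
        · have hP := hlev.2.2.2.1
          exact ⟨(hP.const_nonneg S hAℓ hnℓ i).trans (h ℓ hℓ'),
            hP.exists_sqNorm_QA_le_of_zero S hnℓ (h ℓ hℓ')⟩
        · exact ⟨(h ℓ hℓ').const_nonneg S hAℓ hnℓ i, (h ℓ hℓ').exists_sqNorm_QA_le_of_one S hnℓ⟩
      set rc := (H.R ℓ).conjTranspose.mulVec ((H.A ℓ).mulVec
        (xs - (AMG.richardson (H.A ℓ) ((H.A ℓ).mulVec xs))^[ν] x)) with hrc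
      have hcoarse : ∀ y : Fin (H.dim (ℓ + 1)) → ℂ,
          AMG.sqNorm (AMG.QA (H.A (ℓ + 1)))
              ((H.A (ℓ + 1))⁻¹.mulVec rc - H.wcycle ν d (ℓ + 1) rc y)
            ≤ 1 / (2 * (2 * (c1 / c0) * Cs)) *
              AMG.sqNorm (AMG.QA (H.A (ℓ + 1))) ((H.A (ℓ + 1))⁻¹.mulVec rc - y) := fun y =>
        ih (ℓ + 1) (by omega) rc y _ (by
          rw [Matrix.mulVec_mulVec, Matrix.mul_nonsing_inv _ (hns (ℓ + 1) hℓ'),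
            Matrix.one_mulVec])
      have e : H.wcycle ν (d + 1) ℓ ((H.A ℓ).mulVec xs) x
          = (AMG.richardson (H.A ℓ) ((H.A ℓ).mulVec xs))^[ν] x
            + (H.P ℓ).mulVec (H.wcycle ν d (ℓ + 1) rc (H.wcycle ν d (ℓ + 1) rc 0)) := by
        rw [hrc, Matrix.mulVec_sub]
        rfl
      rw [e]
      refine AMG.sqNorm_wcycle_step_le S hAℓ hnℓ (hinj ℓ hℓ') (hns (ℓ + 1) hℓ') hlev.1 hfap.1 hCs
        ha hb hab rfl hfap.2 (hspec ℓ hℓ') (hst ℓ hℓ') hν xs x _ ?_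
      -- The second coarse cycle starts from the result of the first, which starts from 0; the
      -- contractions multiply to ρ².
      have h2 := (hcoarse (H.wcycle ν d (ℓ + 1) rc 0)).trans
        (mul_le_mul_of_nonneg_left (hcoarse 0) hρ0)
      rw [← mul_assoc, ← pow_two, sub_zero] at h2
      exact h2
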